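/- **Setting.** Let $n,p\ge 1$ and $1\le K\le p$, let $X\in\mathbb{R}^{n\times p}$ be a deterministic design, $\beta\in\mathbb{R}^p$, $\tau>0$, and let $Y=X\beta+\varepsilon$ with $\varepsilon\sim\mathcal{N}_n(0,\tau^2I_n)$. Put $\Sigma=\frac1nX^TX$, $\hat\sigma=\frac1nX^TY$ and $\sigma=\mathbb{E}(\hat\sigma)$. For a symmetric matrix $A$, $\rho(A)$ and $\rho_{\min}(A)$ are its largest and smallest eigenvalues; $\|\cdot\|$ is the $\ell^2$ norm. *PLS estimator.* Set $X^{(1)}=X$ and, for $k=1,\dots,K$, $w_k=X^{(k)T}Y/\|X^{(k)T}Y\|$ (with $w_k=0$ if $X^{(k)T}Y=0$), $t_k=X^{(k)}w_k$ and $X^{(k+1)}=X^{(k)}-P_{[t_k]}X^{(k)}$, where $P_{[t_k]}$ is the orthogonal projection on $\mathrm{span}(t_k)$. The PLS estimator with $K$ components is any $\hat\beta_K\in\arg\min_{b\in\mathrm{span}(w_1,\dots,w_K)}\|Y-Xb\|^2$. *Population quantities.* Let $G=(\sigma,\Sigma\sigma,\dots,\Sigma^{K-1}\sigma)\in\mathbb{R}^{p\times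 K}$, let $[G]$ be its column space, $\Theta=G^T\Sigma G$, $D=\mathrm{diag}(\Theta)$ (so that $D_{ii}=\sigma^T\Sigma^{2i-1}\sigma$), $R=D^{-1/2}\Theta D^{-1/2}$, $\Lambda=\Theta^{-1}G^T\sigma$, $\tilde\Lambda=D^{1/2}\Lambda$ and $\bar\Lambda=D^{-1}G^T\sigma$. *Constants.* For $\delta\in(0,1)$ let $x_\delta=\ln(6K/\delta)$, $C_\delta=\max\bigl(1+2x_\delta+2\sqrt{x_\delta},\,2\sqrt{2x_\delta}\bigr)$ and $$\mathcal{D}^{(1)}_{\delta,R}=32\,C_\delta+8\rho_{\min}(R)\,C_\delta\left(\frac{1}{8\rho_{\min}(R)}+\frac{\rho(R)}{\rho_{\min}(R)^2}\right),$$ $$\mathcal{D}^{(2)}_{\delta,R}=128\,C_\delta^2\,\rho(R)\left(\frac{1}{8\rho_{\min}(R)}+\frac{\rho(R)}{\rho_{\min}(R)^2}\right),$$ $$\mathcal{D}^{(3)}_{\delta,R}=4\frac{C_\delta^2}{\rho_{\min}(R)}\left(2+32\frac{\rho(R)^3}{\rho_{\min}(R)^3}+\frac{4\rho(R)^2}{\rho_{\min}(R)^2}+1\right),$$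 which depend only on $\delta$ and on the $K\times K$ matrix $R$. **Theorem.** Let $\delta\in(0,1)$ and suppose that * (A.1) $\rho_{\min}(R)>0$; * (A.2) for all $i\in\{1,\dots,K\}$, $\ \sigma^T\Sigma^{2i-1}\sigma\ \ge\ t_{\delta,R}\,\frac{\tau^2}{n}\,K\,\rho(\Sigma)^i\,\mathrm{Tr}(\Sigma^i)$, where $t_{\delta,R}\ge 128\,\dfrac{\ln(6K/\delta)}{\rho_{\min}(R)}$. Then, with probability at least $1-\delta$, $$\begin{aligned}\frac1n\|X\hat\beta_K-X\beta\|^2\ \le\ {}&\frac2n\inf_{v\in[G]}\|X(\beta-v)\|^2+\mathcal{D}^{(1)}_{\delta,R}\,\frac{\tau^2}{n}\left(\sum_{i=1}^K\sqrt{\mathrm{Tr}(\Sigma^{2i})}\,|\Lambda_i|\right)^2\\&+\mathcal{D}^{(2)}_{\delta,R}\,\|\tilde\Lambda\|^2\,\frac{\tau^2}{n}\sum_{j=1}^K\frac{\rho(\Sigma)^{2j}}{\sigma^T\Sigma^{2j-1}\sigma}\\&+\mathcal{D}^{(3)}_{\delta,R}\,\frac{\tau^2}{n}\left(\frac{1}{K\,t_{\delta,R}}\sum_{i=1}^K\bar\Lambda_i\,\mathrm{Tr}(\Sigma^i)+\sum_{i=1}^K\bar\Lambda_i\,\rho(\Sigma)^i\right).\end{aligned}$$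 -/

import Mathlib

open MeasureTheory ProbabilityTheory
open scoped Matrix

namespace PLS

noncomputable section

/-! ### General notation -/

/-- The `ℓ²` norm of a vector. -/
def l2norm {m : ℕ} (v : Fin m → ℝ) : ℝ := ‖WithLp.toLp 2 v‖

/-- The highest eigenvalue `ρ(A)` of a real symmetric matrix. -/
def rhoMax {m : ℕ} (A : Matrix (Fin m) (Fin m) ℝ) : ℝ := sSup (spectrum ℝ A)

/-- The lowest eigenvalue `ρ_min(A)` of a real symmetric matrix. -/
def rhoMin {m : ℕ} (A : Matrix (Fin m) (Fin m) ℝ) : ℝ := sInf (spectrum ℝ A)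

/-- The subspace `[A]` spanned by the columns of `A`. -/
def colSpan {m s : ℕ} (A : Matrix (Fin m) (Fin s) ℝ) : Submodule ℝ (Fin m → ℝ) :=
  Submodule.span ℝ (Set.range fun j => A.col j)

/-- The Gram matrix `Σ = Xᵀ X / n` of the design. -/
def gram {n p : ℕ} (X : Matrix (Fin n) (Fin p) ℝ) : Matrix (Fin p) (Fin p) ℝ :=
  (1 / (n : ℝ)) • (Xᵀ * X)

/-- The empirical covariance `σ̂ = Xᵀ Y / n`. -/
def empCov {n p : ℕ} (X : Matrix (Fin n) (Fin p) ℝ) (Y : Fin n → ℝ) : Fin p → ℝ :=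
  (1 / (n : ℝ)) • (Xᵀ *ᵥ Y)

/-! ### The PLS algorithm and the PLS estimator -/

/-- The matrix of the orthogonal projection on the line spanned by `t`
(the zero matrix when `t = 0`). -/
def lineProj {n : ℕ} (t : Fin n → ℝ) : Matrix (Fin n) (Fin n) ℝ :=
  (t ⬝ᵥ t)⁻¹ • Matrix.vecMulVec t t

/-- The loading `Mᵀ Y / ‖Mᵀ Y‖` computed from a (deflated) design `M`. It is `0` when `Mᵀ Y = 0`,
in which case the algorithm has stopped and the following loadings are all `0`. -/
def loadingOf {n p : ℕ} (M : Matrix (Fin n) (Fin p) ℝ) (Y : Fin n → ℝ) : Fin p → ℝ :=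
  (l2norm (Mᵀ *ᵥ Y))⁻¹ • (Mᵀ *ᵥ Y)

/-- The successive deflated designs: the value at `k` is the design used to compute the
`(k + 1)`-st component. -/
def deflated {n p : ℕ} (X : Matrix (Fin n) (Fin p) ℝ) (Y : Fin n → ℝ) :
    ℕ → Matrix (Fin n) (Fin p) ℝ
  | 0 => X
  | k + 1 => deflated X Y k -
      lineProj (deflated X Y k *ᵥ loadingOf (deflated X Y k) Y) * deflated X Y k

/-- The space `[W]` spanned by the first `K` PLS loadings. -/
def loadingSpace {n p : ℕ} (X : Matrix (Fin n) (Fin p) ℝ) (Y : Fin n → ℝ) (K : ℕ) :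
    Submodule ℝ (Fin p → ℝ) :=
  Submodule.span ℝ (Set.range fun k : Fin K => loadingOf (deflated X Y k) Y)

/-- `b` is a PLS estimator with `K` components: `b ∈ argmin_{v ∈ [W]} ‖Y - X v‖²`. -/
def IsPLSEstimator {n p : ℕ} (X : Matrix (Fin n) (Fin p) ℝ) (Y : Fin n → ℝ) (K : ℕ)
    (b : Fin p → ℝ) : Prop :=
  b ∈ loadingSpace X Y K ∧
    IsMinOn (fun v => l2norm (Y - X *ᵥ v) ^ 2) (loadingSpace X Y K : Set (Fin p → ℝ)) b

/-! ### Population Krylov quantities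

Here `S` is the Gram matrix `Σ` and `s` the population covariance `σ`. Indices in `Fin K` start
at `0`, so that the usual index `i` is `i + 1` below. -/

/-- The Krylov matrix `G = (σ, Σσ, …, Σ^{K-1}σ)`. -/
def krylov {p : ℕ} (S : Matrix (Fin p) (Fin p) ℝ) (s : Fin p → ℝ) (K : ℕ) :
    Matrix (Fin p) (Fin K) ℝ :=
  Matrix.of fun a j => ((S ^ (j : ℕ)) *ᵥ s) a

/-- `Θ = Gᵀ Σ G`. -/
def theta {p : ℕ} (S : Matrix (Fin p) (Fin p) ℝ) (s : Fin p → ℝ) (K : ℕ) :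
    Matrix (Fin K) (Fin K) ℝ :=
  (krylov S s K)ᵀ * S * krylov S s K

/-- `R = D^{-1/2} Θ D^{-1/2}` with `D = diag(Θ)`. -/
def corr {p : ℕ} (S : Matrix (Fin p) (Fin p) ℝ) (s : Fin p → ℝ) (K : ℕ) :
    Matrix (Fin K) (Fin K) ℝ :=
  Matrix.diagonal (fun i => (√(theta S s K i i))⁻¹) * theta S s K *
    Matrix.diagonal (fun i => (√(theta S s K i i))⁻¹)

/-- `Λ = Θ⁻¹ Gᵀ σ`. -/
def lam {p : ℕ} (S : Matrix (Fin p) (Fin p) ℝ) (s : Fin p → ℝ) (K : ℕ) : Fin K → ℝ :=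
  (theta S s K)⁻¹ *ᵥ ((krylov S s K)ᵀ *ᵥ s)

/-- `Λ̃ = D^{1/2} Λ`. -/
def lamTilde {p : ℕ} (S : Matrix (Fin p) (Fin p) ℝ) (s : Fin p → ℝ) (K : ℕ) : Fin K → ℝ :=
  Matrix.diagonal (fun i => √(theta S s K i i)) *ᵥ lam S s K

/-- `Λ̄ = D⁻¹ Gᵀ σ`. -/
def lamBar {p : ℕ} (S : Matrix (Fin p) (Fin p) ℝ) (s : Fin p → ℝ) (K : ℕ) : Fin K → ℝ :=
  Matrix.diagonal (fun i => (theta S s K i i)⁻¹) *ᵥ ((krylov S s K)ᵀ *ᵥ s)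

/-! ### The constants -/

/-- `x_δ = ln(6K/δ)`. -/
def xDelta (K : ℕ) (δ : ℝ) : ℝ := Real.log (6 * K / δ)

/-- `C_δ = max(1 + 2 x_δ + 2 √x_δ, 2 √(2 x_δ))`. -/
def cDelta (K : ℕ) (δ : ℝ) : ℝ :=
  max (1 + 2 * xDelta K δ + 2 * √(xDelta K δ)) (2 * √(2 * xDelta K δ))

/-- The first constant, a function of `δ` and of the `K × K` matrix `R` only. -/
def D1 {K : ℕ} (δ : ℝ) (R : Matrix (Fin K) (Fin K) ℝ) : ℝ :=
  32 * cDelta K δ +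
    8 * rhoMin R * cDelta K δ * (1 / (8 * rhoMin R) + rhoMax R / rhoMin R ^ 2)

/-- The second constant, a function of `δ` and of the `K × K` matrix `R` only. -/
def D2 {K : ℕ} (δ : ℝ) (R : Matrix (Fin K) (Fin K) ℝ) : ℝ :=
  128 * cDelta K δ ^ 2 * rhoMax R * (1 / (8 * rhoMin R) + rhoMax R / rhoMin R ^ 2)

/-- The third constant, a function of `δ` and of the `K × K` matrix `R` only. -/
def D3 {K : ℕ} (δ : ℝ) (R : Matrix (Fin K) (Fin K) ℝ) : ℝ :=
  4 * (cDelta K δ ^ 2 / rhoMin R) *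
    (2 + 32 * (rhoMax R ^ 3 / rhoMin R ^ 3) + (4 * rhoMax R ^ 2 / rhoMin R ^ 2 + 1))

end

end PLS

open PLS

namespace PLS

/-! ### Tail bound for Gaussian quadratic forms -/

section GaussianTail

/-! The argument is deterministic once the noise `e` is fixed in a good event. The PLS loadings span
the Krylov space of `Σ` at `σ̂` (`loadingSpace_eq_krylovSpan`), so `X β̂` is the orthogonal
projection of `Y` on the span `V` of the vectors `g i + h i`. Here `g i = X Σ^i σ` is the population
direction and `h i = noiseOp X i *ᵥ e` its perturbation.

The error splits orthogonally into the projection of `e` on `V` and the residual of `X β` off `V`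
(`norm_sq_leastSquares_sub_le`). The residual is at most the distance from `X β` to any chosen point
of `V`. With the coefficients `Λ` of the best population approximation, this gives the infimum and
the term in `|Λ i|`. The projected noise is controlled by the inner products of `e` with the `g i +
h i`, provided the Gram matrix of these vectors is bounded below. (A.1) gives such a bound for the
`g i`, and (A.2) makes the `h i` small enough to lose only a factor 4 (`sum_perturbed_norm_sq_ge`).

The good event bounds three quadratic forms in the noise for each `i` (`goodNoise`). Each bound
fails with probability at most `2 e^{-x}` (`gaussian_sq_norm_mulVec_tail`), and `x = ln(6K/δ)` makes
the union bound equal to `δ`. The stated constants exceed what this argument needs; the second term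
of the bound is used only through its nonnegativity. -/

lemma lintegral_exp_sq_gaussianReal_le (v : NNReal) :
    ∫⁻ x, ENNReal.ofReal (Real.exp (x ^ 2 / (4 * v))) ∂(gaussianReal 0 v)
      ≤ ENNReal.ofReal (√2) := by
  have h1 : (1 : ℝ) ≤ √2 := Real.one_le_sqrt.2 (by norm_num)
  -- For `v = 0` the exponent is a division by zero, so the integrand is 1.
  rcases eq_or_ne v 0 with rfl | hv
  · simp [h1]
  have hv0 : (0 : ℝ) < v := by positivity
  rw [gaussianReal_of_var_ne_zero _ hv, lintegral_withDensity_eq_lintegral_mul _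
    (measurable_gaussianPDF 0 v) (by fun_prop)]
  -- The exponents add up to `-x²/(4v)`, a Gaussian of variance `2v`; the ratio of the
  -- normalizations is `√2`.
  have hpt : ∀ x : ℝ, (gaussianPDF 0 v * fun x => ENNReal.ofReal (Real.exp (x ^ 2 / (4 * v)))) x
      = ENNReal.ofReal ((√(2 * Real.pi * v))⁻¹ * Real.exp (-(1 / (4 * v)) * x ^ 2)) := by
    intro x
    rw [Pi.mul_apply, gaussianPDF, ← ENNReal.ofReal_mul (gaussianPDFReal_nonneg _ _ _),
      gaussianPDFReal, mul_assoc, ← Real.exp_add]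
    congr 3
    field_simp
    ring
  rw [lintegral_congr hpt, ← ofReal_integral_eq_lintegral_ofReal]
  · apply ENNReal.ofReal_le_ofReal
    rw [integral_const_mul, integral_gaussian, ← Real.sqrt_inv, ← Real.sqrt_mul (by positivity)]
    apply le_of_eq
    congr 1
    field_simp
    norm_num
  · exact (integrable_exp_neg_mul_sq (by positivity)).const_mul _
  · exact Filter.Eventually.of_forall fun x => by positivity

variable {n : ℕ}

lemma map_dotProduct_multivariateGaussian (τ : ℝ) (a : Fin n → ℝ) :
    (multivariateGaussian (0 : EuclideanSpace ℝ (Fin n))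
      (τ ^ 2 • (1 : Matrix (Fin n) (Fin n) ℝ))).map (fun x => a ⬝ᵥ x.ofLp)
      = gaussianReal 0 (τ ^ 2 * (a ⬝ᵥ a)).toNNReal := by
  have hS : (τ ^ 2 • (1 : Matrix (Fin n) (Fin n) ℝ)).PosSemidef :=
    Matrix.PosSemidef.one.smul (sq_nonneg τ)
  have hL : (fun x : EuclideanSpace ℝ (Fin n) => a ⬝ᵥ x.ofLp)
      = innerSL ℝ (WithLp.toLp 2 a) := by
    ext x
    simp [PiLp.inner_apply, dotProduct, mul_comm]
  rw [hL, IsGaussian.map_eq_gaussianReal, ContinuousLinearMap.integral_comp_id_comm]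
  · have : Var[innerSL ℝ (WithLp.toLp 2 a); multivariateGaussian
        (0 : EuclideanSpace ℝ (Fin n)) (τ ^ 2 • (1 : Matrix (Fin n) (Fin n) ℝ))]
        = τ ^ 2 * (a ⬝ᵥ a) := by
      have := covarianceBilin_self (μ := multivariateGaussian
        (0 : EuclideanSpace ℝ (Fin n)) (τ ^ 2 • (1 : Matrix (Fin n) (Fin n) ℝ)))
        IsGaussian.memLp_two_id (WithLp.toLp 2 a)
      rw [covarianceBilin_multivariateGaussian hS] at this
      rw [show (⇑(innerSL ℝ (WithLp.toLp 2 a)) : EuclideanSpace ℝ (Fin n) → ℝ) =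
        fun u => inner ℝ (WithLp.toLp 2 a) u from by ext; simp, ← this]
      simp [Matrix.smul_mulVec]
    rw [this]
    simp
  · exact IsGaussian.integrable_id

lemma lintegral_exp_dotProduct_sq_le (τ : ℝ) (a : Fin n → ℝ) :
    ∫⁻ x, ENNReal.ofReal (Real.exp ((a ⬝ᵥ x.ofLp) ^ 2 / (4 * (τ ^ 2 * (a ⬝ᵥ a)))))
      ∂(multivariateGaussian (0 : EuclideanSpace ℝ (Fin n))
        (τ ^ 2 • (1 : Matrix (Fin n) (Fin n) ℝ))) ≤ ENNReal.ofReal (√2) := by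
  have h := lintegral_exp_sq_gaussianReal_le (τ ^ 2 * (a ⬝ᵥ a)).toNNReal
  rw [← map_dotProduct_multivariateGaussian, lintegral_map (by fun_prop)
    (by unfold dotProduct; fun_prop)] at h
  have h0 : 0 ≤ τ ^ 2 * (a ⬝ᵥ a) :=
    mul_nonneg (sq_nonneg _) (Finset.sum_nonneg fun i _ => mul_self_nonneg _)
  rwa [Real.coe_toNNReal _ h0] at h

lemma trace_transpose_mul_self {m : ℕ} (B : Matrix (Fin m) (Fin n) ℝ) :
    (Bᵀ * B).trace = ∑ j, B j ⬝ᵥ B j := by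
  rw [Matrix.trace_mul_comm]
  simp [Matrix.trace, Matrix.mul_apply, dotProduct]

/-- With `F` the trace, `‖B e‖² / (4 τ² F)` is the average of the normalized squares `q j` with
weights `‖B j‖² / F`. By convexity of `exp` its exponential moment is at most that of a single
normalized square, namely `√2`, and Markov's inequality concludes. Neither independence of the rows
nor diagonalization is needed. -/
theorem gaussian_sq_norm_mulVec_tail {m : ℕ} {τ : ℝ} (hτ : 0 < τ) (B : Matrix (Fin m) (Fin n) ℝ)
    (x : ℝ) :
    multivariateGaussian (0 : EuclideanSpace ℝ (Fin n)) (τ ^ 2 • (1 : Matrix (Fin n) (Fin n) ℝ))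
      {e | 4 * x * τ ^ 2 * (Bᵀ * B).trace < (B *ᵥ e.ofLp) ⬝ᵥ (B *ᵥ e.ofLp)}
      ≤ ENNReal.ofReal (2 * Real.exp (-x)) := by
  have hnn : ∀ j, 0 ≤ B j ⬝ᵥ B j := fun j => Finset.sum_nonneg fun i _ => mul_self_nonneg _
  set F := (Bᵀ * B).trace with hF
  have hFs : F = ∑ j, B j ⬝ᵥ B j := trace_transpose_mul_self B
  have hF0 : 0 ≤ F := hFs ▸ Finset.sum_nonneg fun j _ => hnn j
  have hrow : ∀ j, B j ⬝ᵥ B j = 0 → B j = 0 := fun j => dotProduct_self_eq_zero.1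
  rcases hF0.eq_or_lt with h0 | hpos
  · have hB : B = 0 := by
      ext j k
      have := (Finset.sum_eq_zero_iff_of_nonneg fun j _ => hnn j).1 (hFs.symm.trans h0.symm) j
        (Finset.mem_univ j)
      exact congrFun (hrow j this) k
    simp [hB, ← h0]
  set μ := multivariateGaussian (0 : EuclideanSpace ℝ (Fin n))
    (τ ^ 2 • (1 : Matrix (Fin n) (Fin n) ℝ))
  set q : Fin m → EuclideanSpace ℝ (Fin n) → ℝ :=
    fun j e => (B j ⬝ᵥ e.ofLp) ^ 2 / (4 * (τ ^ 2 * (B j ⬝ᵥ B j))) with hq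
  set w : Fin m → ℝ := fun j => (B j ⬝ᵥ B j) / F with hw
  have hw0 : ∀ j, 0 ≤ w j := fun j => div_nonneg (hnn j) hF0
  have hw1 : ∑ j, w j = 1 := by
    rw [← Finset.sum_div, ← hFs, div_self hpos.ne']
  have hsum : ∀ e : EuclideanSpace ℝ (Fin n), ∑ j, w j * q j e
      = ((B *ᵥ e.ofLp) ⬝ᵥ (B *ᵥ e.ofLp)) / (4 * τ ^ 2 * F) := by
    intro e
    rw [dotProduct, Finset.sum_div]
    refine Finset.sum_congr rfl fun j _ => ?_
    simp only [hw, hq, Matrix.mulVec]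
    rcases eq_or_ne (B j ⬝ᵥ B j) 0 with hz | hz
    · simp [hrow j hz]
    · field_simp
  have hqm : ∀ j, Measurable (q j) := fun j => by
    simp only [hq, dotProduct]; fun_prop
  have hint : ∫⁻ e, ENNReal.ofReal (Real.exp (∑ j, w j * q j e)) ∂μ ≤ ENNReal.ofReal (√2) := by
    calc ∫⁻ e, ENNReal.ofReal (Real.exp (∑ j, w j * q j e)) ∂μ
        ≤ ∫⁻ e, ∑ j, ENNReal.ofReal (w j) * ENNReal.ofReal (Real.exp (q j e)) ∂μ := by
          refine lintegral_mono fun e => ?_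
          have := convexOn_exp.map_sum_le (t := Finset.univ) (w := w) (p := fun j => q j e)
            (fun j _ => hw0 j) hw1 (fun j _ => Set.mem_univ _)
          simp only [smul_eq_mul] at this
          refine (ENNReal.ofReal_le_ofReal this).trans ?_
          rw [ENNReal.ofReal_sum_of_nonneg fun j _ => mul_nonneg (hw0 j) (Real.exp_pos _).le]
          exact le_of_eq (Finset.sum_congr rfl fun j _ => ENNReal.ofReal_mul (hw0 j))
      _ = ∑ j, ENNReal.ofReal (w j) * ∫⁻ e, ENNReal.ofReal (Real.exp (q j e)) ∂μ := by
          rw [lintegral_finsetSum]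
          · refine Finset.sum_congr rfl fun j _ => lintegral_const_mul _ ?_
            have := hqm j; fun_prop
          · intro j _
            have := hqm j; fun_prop
      _ ≤ ∑ j, ENNReal.ofReal (w j) * ENNReal.ofReal (√2) :=
          Finset.sum_le_sum fun j _ => mul_le_mul_right (lintegral_exp_dotProduct_sq_le τ (B j)) _
      _ = ENNReal.ofReal (√2) := by
          rw [← Finset.sum_mul, ← ENNReal.ofReal_sum_of_nonneg fun j _ => hw0 j, hw1]
          simp
  have hm : Measurable fun e => ENNReal.ofReal (Real.exp (∑ j, w j * q j e)) := by fun_prop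
  have hmarkov := mul_meas_ge_le_lintegral (μ := μ) hm (ENNReal.ofReal (Real.exp x))
  have hsub : {e : EuclideanSpace ℝ (Fin n) |
      4 * x * τ ^ 2 * F < (B *ᵥ e.ofLp) ⬝ᵥ (B *ᵥ e.ofLp)}
      ⊆ {e | ENNReal.ofReal (Real.exp x) ≤ ENNReal.ofReal (Real.exp (∑ j, w j * q j e))} := by
    intro e he
    refine ENNReal.ofReal_le_ofReal (Real.exp_le_exp.2 ?_)
    rw [hsum, le_div_iff₀ (by positivity)]
    have : 4 * x * τ ^ 2 * F < (B *ᵥ e.ofLp) ⬝ᵥ (B *ᵥ e.ofLp) := he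
    linarith
  refine (measure_mono hsub).trans ?_
  have h2 : √2 ≤ 2 := Real.sqrt_le_iff.2 ⟨by norm_num, by norm_num⟩
  have h3 := (hmarkov.trans hint).trans (ENNReal.ofReal_le_ofReal h2)
  rw [mul_comm] at h3
  rw [Real.exp_neg, ← div_eq_mul_inv, ENNReal.ofReal_div_of_pos (Real.exp_pos x)]
  rwa [ENNReal.le_div_iff_mul_le (Or.inl (by simp [Real.exp_pos])) (Or.inl (by simp))]

end GaussianTail

/-! ### The loading space is a Krylov space -/

section LoadingSpace

variable {n p : ℕ} (X : Matrix (Fin n) (Fin p) ℝ) (Y : Fin n → ℝ)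

lemma l2norm_sq {m : ℕ} (v : Fin m → ℝ) : l2norm v ^ 2 = v ⬝ᵥ v := by
  rw [l2norm, EuclideanSpace.real_norm_sq_eq]
  simp [dotProduct, sq]

lemma l2norm_eq_zero {m : ℕ} {v : Fin m → ℝ} : l2norm v = 0 ↔ v = 0 := by
  simp [l2norm]

/-- The Krylov space of order `k` of `A` at `s`. -/
def krylovSpan (A : Matrix (Fin p) (Fin p) ℝ) (s : Fin p → ℝ) (k : ℕ) :
    Submodule ℝ (Fin p → ℝ) :=
  Submodule.span ℝ (Set.range fun j : Fin k => (A ^ (j : ℕ)) *ᵥ s)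

lemma krylovSpan_mono (A : Matrix (Fin p) (Fin p) ℝ) (s : Fin p → ℝ) :
    Monotone (krylovSpan A s) := by
  intro k l hkl
  refine Submodule.span_le.2 ?_
  rintro _ ⟨j, rfl⟩
  exact Submodule.subset_span ⟨⟨j, j.2.trans_le hkl⟩, rfl⟩

lemma mulVec_mem_krylovSpan (A : Matrix (Fin p) (Fin p) ℝ) (s : Fin p → ℝ) (k : ℕ)
    {v : Fin p → ℝ} (hv : v ∈ krylovSpan A s k) : A *ᵥ v ∈ krylovSpan A s (k + 1) := by
  have : krylovSpan A s k ≤ (krylovSpan A s (k + 1)).comap A.mulVecLin := by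
    refine Submodule.span_le.2 ?_
    rintro _ ⟨j, rfl⟩
    refine Submodule.subset_span ⟨⟨j + 1, by omega⟩, ?_⟩
    simp [pow_succ']
  exact this hv

lemma loadingSpace_mono : Monotone (loadingSpace X Y) := by
  intro k l hkl
  refine Submodule.span_le.2 ?_
  rintro _ ⟨j, rfl⟩
  exact Submodule.subset_span ⟨⟨j, j.2.trans_le hkl⟩, rfl⟩

lemma loading_mem (k : ℕ) : loadingOf (deflated X Y k) Y ∈ loadingSpace X Y (k + 1) :=
  Submodule.subset_span ⟨⟨k, by omega⟩, rfl⟩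

lemma loadingSpace_succ_le {k : ℕ} {V : Submodule ℝ (Fin p → ℝ)} (h : loadingSpace X Y k ≤ V)
    (hk : loadingOf (deflated X Y k) Y ∈ V) : loadingSpace X Y (k + 1) ≤ V := by
  refine Submodule.span_le.2 ?_
  rintro _ ⟨j, rfl⟩
  rcases (Nat.lt_succ_iff.1 j.2).lt_or_eq with hj | hj
  · exact h (Submodule.subset_span ⟨⟨j, hj⟩, rfl⟩)
  · simpa only [hj, SetLike.mem_coe] using hk

/-- The `k`-th PLS component. -/
noncomputable def component (k : ℕ) : Fin n → ℝ :=
  deflated X Y k *ᵥ loadingOf (deflated X Y k) Y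

/-- The coefficient of `Y` along the `k`-th PLS component. -/
noncomputable def componentCoeff (k : ℕ) : ℝ :=
  (component X Y k ⬝ᵥ component X Y k)⁻¹ * (component X Y k ⬝ᵥ Y)

lemma lineProj_mulVec (t u : Fin n → ℝ) : lineProj t *ᵥ u = ((t ⬝ᵥ t)⁻¹ * (t ⬝ᵥ u)) • t := by
  rw [lineProj, Matrix.smul_mulVec, Matrix.vecMulVec_mulVec]
  ext i
  simp [mul_assoc, mul_comm]

lemma lineProj_transpose (t : Fin n → ℝ) : (lineProj t)ᵀ = lineProj t := by
  rw [lineProj, Matrix.transpose_smul, Matrix.transpose_vecMulVec]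

lemma deflated_succ_mulVec (k : ℕ) (u : Fin p → ℝ) :
    deflated X Y (k + 1) *ᵥ u = deflated X Y k *ᵥ u -
      ((component X Y k ⬝ᵥ component X Y k)⁻¹ *
        (component X Y k ⬝ᵥ (deflated X Y k *ᵥ u))) • component X Y k := by
  rw [deflated, Matrix.sub_mulVec, ← Matrix.mulVec_mulVec, lineProj_mulVec]
  rfl

lemma deflated_succ_transpose_mulVec (k : ℕ) (u : Fin n → ℝ) :
    (deflated X Y (k + 1))ᵀ *ᵥ u = (deflated X Y k)ᵀ *ᵥ u -
      ((component X Y k ⬝ᵥ component X Y k)⁻¹ * (component X Y k ⬝ᵥ u)) •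
        ((deflated X Y k)ᵀ *ᵥ component X Y k) := by
  rw [deflated, Matrix.transpose_sub, Matrix.sub_mulVec, Matrix.transpose_mul,
    ← Matrix.mulVec_mulVec, lineProj_transpose, lineProj_mulVec, Matrix.mulVec_smul]
  rfl

/-- A deflation annihilates its own component. An earlier component is already annihilated by the
current design, hence orthogonal to the new component, which lies in the range of that design; so
the new deflation leaves it annihilated. -/
lemma deflated_transpose_component_eq_zero {j k : ℕ} (h : j < k) :
    (deflated X Y k)ᵀ *ᵥ component X Y j = 0 := by
  induction k with
  | zero => omega
  | succ k ih =>
    rw [deflated_succ_transpose_mulVec]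
    rcases (Nat.lt_succ_iff.1 h).lt_or_eq with hj | rfl
    · have : component X Y k ⬝ᵥ component X Y j = 0 := by
        rw [component, dotProduct_comm, Matrix.dotProduct_mulVec, ← Matrix.mulVec_transpose, ih hj,
          zero_dotProduct]
      rw [ih hj, this]; simp
    · rcases eq_or_ne (component X Y j ⬝ᵥ component X Y j) 0 with h0 | h0
      · rw [dotProduct_self_eq_zero.1 h0]; simp
      · rw [inv_mul_cancel₀ h0, one_smul, sub_self]

lemma component_orthogonal {j k : ℕ} (h : j < k) :
    component X Y j ⬝ᵥ component X Y k = 0 := by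
  conv_lhs => rw [component.eq_1 X Y k]
  rw [Matrix.dotProduct_mulVec, ← Matrix.mulVec_transpose,
    deflated_transpose_component_eq_zero X Y h, zero_dotProduct]

lemma deflated_transpose_mulVec_of_orthogonal {k : ℕ} {u : Fin n → ℝ}
    (hu : ∀ j < k, component X Y j ⬝ᵥ u = 0) : (deflated X Y k)ᵀ *ᵥ u = Xᵀ *ᵥ u := by
  induction k with
  | zero => rfl
  | succ k ih =>
    rw [deflated_succ_transpose_mulVec, hu k (by omega), ih fun j hj => hu j (by omega)]
    simp

lemma deflated_transpose_component (k : ℕ) :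
    (deflated X Y k)ᵀ *ᵥ component X Y k = Xᵀ *ᵥ component X Y k :=
  deflated_transpose_mulVec_of_orthogonal X Y fun _ hj => component_orthogonal X Y hj

/-- Each deflated design acts as `X` up to a correction in the previous loadings. -/
lemma exists_deflated_mulVec_eq (k : ℕ) :
    ∀ u : Fin p → ℝ, ∃ v ∈ loadingSpace X Y k, deflated X Y k *ᵥ u = X *ᵥ (u - v) := by
  induction k with
  | zero => exact fun u => ⟨0, Submodule.zero_mem _, by simp [deflated]⟩
  | succ k ih =>
    intro u
    obtain ⟨v, hv, hvu⟩ := ih u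
    obtain ⟨v', hv', hvu'⟩ := ih (loadingOf (deflated X Y k) Y)
    have hle := loadingSpace_mono X Y (Nat.le_succ k)
    set c := (component X Y k ⬝ᵥ component X Y k)⁻¹ *
        (component X Y k ⬝ᵥ (deflated X Y k *ᵥ u))
    refine ⟨v + c • (loadingOf (deflated X Y k) Y - v'), ?_, ?_⟩
    · exact Submodule.add_mem _ (hle hv) (Submodule.smul_mem _ _
        (Submodule.sub_mem _ (loading_mem X Y k) (hle hv')))
    · rw [deflated_succ_mulVec]
      change deflated X Y k *ᵥ u - c • component X Y k = _
      clear_value c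
      rw [show component X Y k = _ from hvu', hvu]
      simp only [Matrix.mulVec_sub, Matrix.mulVec_add, Matrix.mulVec_smul]
      abel

lemma transpose_mulVec_eq_smul_loading (M : Matrix (Fin n) (Fin p) ℝ) :
    Mᵀ *ᵥ Y = l2norm (Mᵀ *ᵥ Y) • loadingOf M Y := by
  rw [loadingOf, smul_smul]
  rcases eq_or_ne (l2norm (Mᵀ *ᵥ Y)) 0 with h | h
  · rw [l2norm_eq_zero.1 h]; simp
  · rw [mul_inv_cancel₀ h, one_smul]

lemma transpose_mulVec_mem_loadingSpace (k : ℕ) :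
    (deflated X Y k)ᵀ *ᵥ Y ∈ loadingSpace X Y (k + 1) := by
  rw [transpose_mulVec_eq_smul_loading]
  exact Submodule.smul_mem _ _ (loading_mem X Y k)

/-- The product of `Y` with the component is the norm of `Mᵀ Y`, for `M` the deflated design, so a
vanishing coefficient occurs only once the algorithm has stopped. -/
lemma loading_eq_zero_of_coeff_eq_zero {k : ℕ} (h : componentCoeff X Y k = 0) :
    loadingOf (deflated X Y k) Y = 0 := by
  have h1 : component X Y k ⬝ᵥ Y = 0 := by
    rcases mul_eq_zero.1 h with h | h
    · rw [dotProduct_self_eq_zero.1 (inv_eq_zero.1 h), zero_dotProduct]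
    · exact h
  have h2 : component X Y k ⬝ᵥ Y =
      (l2norm ((deflated X Y k)ᵀ *ᵥ Y))⁻¹ * l2norm ((deflated X Y k)ᵀ *ᵥ Y) ^ 2 := by
    rw [component, dotProduct_comm, Matrix.dotProduct_mulVec, ← Matrix.mulVec_transpose, l2norm_sq,
      loadingOf, dotProduct_smul, smul_eq_mul]
  have h3 : l2norm ((deflated X Y k)ᵀ *ᵥ Y) = 0 := by
    by_contra hne
    rw [h2] at h1
    rcases mul_eq_zero.1 h1 with h | h
    · exact hne (inv_eq_zero.1 h)
    · exact hne (pow_eq_zero_iff (by norm_num) |>.1 h)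
  rw [loadingOf, l2norm_eq_zero.1 h3, smul_zero]

lemma smul_gram_mulVec (hn : n ≠ 0) (v : Fin p → ℝ) : Xᵀ *ᵥ (X *ᵥ v) = (n : ℝ) • (gram X *ᵥ v) := by
  have : (n : ℝ) ≠ 0 := by exact_mod_cast hn
  rw [gram, Matrix.smul_mulVec, smul_smul, mul_one_div_cancel this, one_smul,
    Matrix.mulVec_mulVec]

lemma exists_component_eq (k : ℕ) : ∃ v ∈ loadingSpace X Y k,
    component X Y k = X *ᵥ (loadingOf (deflated X Y k) Y - v) :=
  exists_deflated_mulVec_eq X Y k _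

/-- This recurrence drives both inclusions between loading and Krylov spaces: read forward, it
bounds the degree of the next loading; solved for the Gram term, it shows that `Σ` maps each loading
space into the next. -/
lemma deflated_succ_transpose_mulVec_self (hn : n ≠ 0) {k : ℕ} {v : Fin p → ℝ}
    (hv : component X Y k = X *ᵥ (loadingOf (deflated X Y k) Y - v)) :
    (deflated X Y (k + 1))ᵀ *ᵥ Y = (deflated X Y k)ᵀ *ᵥ Y - (componentCoeff X Y k * n) •
      (gram X *ᵥ (loadingOf (deflated X Y k) Y - v)) := by
  rw [deflated_succ_transpose_mulVec, deflated_transpose_component, ← componentCoeff,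
    mul_smul, ← smul_gram_mulVec X hn, ← hv]

lemma smul_empCov (hn : n ≠ 0) : Xᵀ *ᵥ Y = (n : ℝ) • empCov X Y := by
  have : (n : ℝ) ≠ 0 := by exact_mod_cast hn
  rw [empCov, smul_smul, mul_one_div_cancel this, one_smul]

lemma loadingSpace_le_krylovSpan (hn : n ≠ 0) (k : ℕ) :
    loadingSpace X Y k ≤ krylovSpan (gram X) (empCov X Y) k ∧
      (deflated X Y k)ᵀ *ᵥ Y ∈ krylovSpan (gram X) (empCov X Y) (k + 1) := by
  induction k with
  | zero =>
    refine ⟨Submodule.span_le.2 (by rintro _ ⟨j, -⟩; exact j.elim0), ?_⟩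
    rw [deflated, smul_empCov X Y hn]
    exact Submodule.smul_mem _ _ (Submodule.subset_span ⟨0, by simp⟩)
  | succ k ih =>
    have hw : loadingOf (deflated X Y k) Y ∈ krylovSpan (gram X) (empCov X Y) (k + 1) :=
      Submodule.smul_mem _ _ ih.2
    have hle := krylovSpan_mono (gram X) (empCov X Y) (Nat.le_succ k)
    refine ⟨loadingSpace_succ_le X Y (ih.1.trans hle) hw, ?_⟩
    obtain ⟨v, hv, hvc⟩ := exists_component_eq X Y k
    rw [deflated_succ_transpose_mulVec_self X Y hn hvc]
    refine Submodule.sub_mem _ (krylovSpan_mono _ _ (Nat.le_succ _) ih.2)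
      (Submodule.smul_mem _ _ (mulVec_mem_krylovSpan _ _ _ (Submodule.sub_mem _ hw (hle (ih.1 hv)))))

lemma gram_mulVec_mem_loadingSpace (hn : n ≠ 0) (k : ℕ) :
    loadingSpace X Y k ≤ (loadingSpace X Y (k + 1)).comap (gram X).mulVecLin := by
  induction k with
  | zero => exact Submodule.span_le.2 (by rintro _ ⟨j, -⟩; exact j.elim0)
  | succ k ih =>
    have hle := loadingSpace_mono X Y (Nat.le_succ (k + 1))
    refine loadingSpace_succ_le X Y (ih.trans (Submodule.comap_mono hle)) ?_
    rw [Submodule.mem_comap, Matrix.mulVecLin_apply]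
    -- Solving the recurrence divides by this coefficient; when it vanishes the loading is zero and
    -- there is nothing to prove.
    rcases eq_or_ne (componentCoeff X Y k) 0 with h0 | h0
    · rw [loading_eq_zero_of_coeff_eq_zero X Y h0, Matrix.mulVec_zero]
      exact Submodule.zero_mem _
    obtain ⟨v, hv, hvc⟩ := exists_component_eq X Y k
    have h1 : (componentCoeff X Y k * n) • (gram X *ᵥ (loadingOf (deflated X Y k) Y - v))
        ∈ loadingSpace X Y (k + 2) := by
      have := deflated_succ_transpose_mulVec_self X Y hn hvc
      rw [show (componentCoeff X Y k * n) • (gram X *ᵥ (loadingOf (deflated X Y k) Y - v))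
        = (deflated X Y k)ᵀ *ᵥ Y - (deflated X Y (k + 1))ᵀ *ᵥ Y by rw [this]; abel]
      exact Submodule.sub_mem _ (hle (transpose_mulVec_mem_loadingSpace X Y k))
        (transpose_mulVec_mem_loadingSpace X Y (k + 1))
    have hn' : (n : ℝ) ≠ 0 := by exact_mod_cast hn
    rw [Submodule.smul_mem_iff _ (mul_ne_zero h0 hn'), Matrix.mulVec_sub] at h1
    have h2 : gram X *ᵥ v ∈ loadingSpace X Y (k + 2) := hle (ih hv)
    simpa using Submodule.add_mem _ h1 h2

/-- The space of the PLS loadings is the Krylov space of the empirical covariances. -/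
theorem loadingSpace_eq_krylovSpan (hn : n ≠ 0) (k : ℕ) :
    loadingSpace X Y k = krylovSpan (gram X) (empCov X Y) k := by
  refine le_antisymm (loadingSpace_le_krylovSpan X Y hn k).1 (Submodule.span_le.2 ?_)
  have key : ∀ j : ℕ, ((gram X) ^ j) *ᵥ empCov X Y ∈ loadingSpace X Y (j + 1) := by
    intro j
    induction j with
    | zero =>
      have hn' : (n : ℝ) ≠ 0 := by exact_mod_cast hn
      have := transpose_mulVec_mem_loadingSpace X Y 0
      rw [deflated, smul_empCov X Y hn, Submodule.smul_mem_iff _ hn'] at this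
      simpa using this
    | succ j ih =>
      have := gram_mulVec_mem_loadingSpace X Y hn (j + 1) ih
      simpa [pow_succ'] using this
  rintro _ ⟨j, rfl⟩
  exact loadingSpace_mono X Y j.2 (key j)

end LoadingSpace

/-! ### Eigenvalue bounds -/

section Spectrum

open scoped MatrixOrder

variable {m : ℕ} {A : Matrix (Fin m) (Fin m) ℝ}

lemma rhoMin_mul_dotProduct_le (hA : A.IsHermitian) (a : Fin m → ℝ) :
    rhoMin A * (a ⬝ᵥ a) ≤ a ⬝ᵥ (A *ᵥ a) := by
  have h : algebraMap ℝ _ (rhoMin A) ≤ A :=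
    (algebraMap_le_iff_le_spectrum (ha := hA.isSelfAdjoint)).2 fun x hx =>
      csInf_le (Matrix.finite_spectrum A).bddBelow hx
  have h2 := (Matrix.le_iff.1 h).dotProduct_mulVec_nonneg a
  rw [Algebra.algebraMap_eq_smul_one, Matrix.sub_mulVec, Matrix.smul_mulVec, Matrix.one_mulVec,
    dotProduct_sub, dotProduct_smul, smul_eq_mul, star_trivial] at h2
  linarith

/-- By functional calculus: the polynomial `x^j (ρ^i - x^i)` is nonnegative on the spectrum, which
lies in `[0, ρ]`. It is used both as a quadratic form at `σ` and through its trace. -/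
lemma posSemidef_rhoMax_pow_smul_sub (hA : A.PosSemidef) (i j : ℕ) :
    (rhoMax A ^ i • A ^ j - A ^ (j + i)).PosSemidef := by
  have hsa : IsSelfAdjoint A := hA.1.isSelfAdjoint
  have h : rhoMax A ^ i • A ^ j - A ^ (j + i)
      = cfc (fun x : ℝ => rhoMax A ^ i * x ^ j - x ^ (j + i)) A := by
    rw [cfc_sub .., cfc_const_mul .., cfc_pow_id .., cfc_pow_id ..]
  rw [h, ← Matrix.nonneg_iff_posSemidef]
  refine cfc_nonneg fun x hx => ?_
  have hx0 : 0 ≤ x := spectrum_nonneg_of_nonneg (Matrix.nonneg_iff_posSemidef.2 hA) hx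
  have hxm : x ≤ rhoMax A := le_csSup (Matrix.finite_spectrum A).bddAbove hx
  rw [pow_add, mul_comm, sub_nonneg]
  exact mul_le_mul_of_nonneg_left (pow_le_pow_left₀ hx0 hxm i) (pow_nonneg hx0 j)

lemma rhoMin_le_rhoMax (hA : A.IsHermitian) (hm : m ≠ 0) : rhoMin A ≤ rhoMax A := by
  have : Nonempty (Fin m) := ⟨⟨0, by omega⟩⟩
  refine csInf_le_csSup ?_ (Matrix.finite_spectrum A).bddBelow (Matrix.finite_spectrum A).bddAbove
  rw [hA.spectrum_real_eq_range_eigenvalues]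
  exact Set.range_nonempty _

lemma rhoMax_nonneg (hA : A.PosSemidef) : 0 ≤ rhoMax A :=
  Real.sSup_nonneg fun _ hx => spectrum_nonneg_of_nonneg (Matrix.nonneg_iff_posSemidef.2 hA) hx

lemma exists_eq_transpose_mul_self (hA : A.PosSemidef) :
    ∃ B : Matrix (Fin m) (Fin m) ℝ, A = Bᵀ * B := by
  obtain ⟨B, hB⟩ := CStarAlgebra.nonneg_iff_eq_star_mul_self.1 (Matrix.nonneg_iff_posSemidef.2 hA)
  exact ⟨B, by simpa [Matrix.star_eq_conjTranspose] using hB⟩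

end Spectrum

/-! ### Least squares over a perturbed span -/

section LeastSquares

variable {E : Type*} [NormedAddCommGroup E] [InnerProductSpace ℝ E] {K : ℕ}

/-- By Cauchy–Schwarz over the `K` terms, the perturbation has norm at most half the lower bound for
the `g` part. The reverse triangle inequality keeps the other half, hence a quarter after squaring.
-/
lemma sum_perturbed_norm_sq_ge {g h : Fin K → E} {d : Fin K → ℝ} (hd : ∀ i, 0 < d i) {ρ : ℝ}
    (hρ : 0 < ρ)
    (hg : ∀ a : Fin K → ℝ, ρ * ∑ i, d i * a i ^ 2 ≤ ‖∑ i, a i • g i‖ ^ 2)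
    (hh : ∀ i, 4 * K * ‖h i‖ ^ 2 ≤ ρ * d i) (a : Fin K → ℝ) :
    ρ / 4 * ∑ i, d i * a i ^ 2 ≤ ‖∑ i, a i • (g i + h i)‖ ^ 2 := by
  set T := ∑ i, d i * a i ^ 2
  have hT : 0 ≤ T := Finset.sum_nonneg fun i _ => mul_nonneg (hd i).le (sq_nonneg _)
  set s := √(ρ * T)
  have hs : s ^ 2 = ρ * T := Real.sq_sqrt (by positivity)
  have hs0 : 0 ≤ s := Real.sqrt_nonneg _
  have hG : s ≤ ‖∑ i, a i • g i‖ := Real.sqrt_le_iff.2 ⟨norm_nonneg _, hg a⟩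
  have hH2 : ‖∑ i, a i • h i‖ ^ 2 ≤ (s / 2) ^ 2 := by
    calc ‖∑ i, a i • h i‖ ^ 2 ≤ (∑ i, ‖a i • h i‖) ^ 2 := by gcongr; exact norm_sum_le _ _
      _ ≤ K * ∑ i, ‖a i • h i‖ ^ 2 := by
          simpa using sq_sum_le_card_mul_sum_sq (s := Finset.univ) (f := fun i => ‖a i • h i‖)
      _ = ∑ i, a i ^ 2 / 4 * (4 * K * ‖h i‖ ^ 2) := by
          rw [Finset.mul_sum]
          refine Finset.sum_congr rfl fun i _ => ?_
          rw [norm_smul, mul_pow, Real.norm_eq_abs, sq_abs]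
          ring
      _ ≤ ∑ i, a i ^ 2 / 4 * (ρ * d i) :=
          Finset.sum_le_sum fun i _ => mul_le_mul_of_nonneg_left (hh i) (by positivity)
      _ = (s / 2) ^ 2 := by
          rw [div_pow, hs, Finset.mul_sum, Finset.sum_div]
          exact Finset.sum_congr rfl fun i _ => by ring
  have hH : ‖∑ i, a i • h i‖ ≤ s / 2 := by
    exact (pow_le_pow_iff_left₀ (norm_nonneg _) (by positivity) two_ne_zero).1 hH2
  have hsum : ∑ i, a i • (g i + h i) = ∑ i, a i • g i + ∑ i, a i • h i := by
    simp [smul_add, Finset.sum_add_distrib]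
  have hge : s / 2 ≤ ‖∑ i, a i • (g i + h i)‖ := by
    have := norm_sub_le_norm_add (∑ i, a i • g i) (∑ i, a i • h i)
    rw [hsum]
    linarith
  calc ρ / 4 * T = (s / 2) ^ 2 := by rw [div_pow, hs]; ring
    _ ≤ _ := by gcongr

/-- The part of `e` in the span of `g`, when the Gram matrix of `g` is bounded below. -/
lemma norm_sq_le_of_mem_span {u : Fin K → E} {d : Fin K → ℝ} (hd : ∀ i, 0 < d i) {c : ℝ}
    (hc : 0 < c) (hu : ∀ a : Fin K → ℝ, c * ∑ i, d i * a i ^ 2 ≤ ‖∑ i, a i • u i‖ ^ 2) {e q : E}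
    (hq : q ∈ Submodule.span ℝ (Set.range u)) (hqe : inner ℝ (e - q) q = 0) :
    ‖q‖ ^ 2 ≤ 1 / c * ∑ i, inner ℝ (u i) e ^ 2 / d i := by
  obtain ⟨a, rfl⟩ := (Submodule.mem_span_range_iff_exists_fun ℝ).1 hq
  set q := ∑ i, a i • u i
  have h1 : ‖q‖ ^ 2 = ∑ i, a i * inner ℝ (u i) e := by
    rw [inner_sub_left, real_inner_self_eq_norm_sq, sub_eq_zero] at hqe
    rw [← hqe, real_inner_comm, sum_inner]
    exact Finset.sum_congr rfl fun i _ => real_inner_smul_left _ _ _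
  set Z := ∑ i, inner ℝ (u i) e ^ 2 / d i
  have hZ : 0 ≤ Z := Finset.sum_nonneg fun i _ => div_nonneg (sq_nonneg _) (hd i).le
  -- Cauchy–Schwarz with weights `d i`, applied to `‖q‖² = ⟨q, e⟩`; one factor `‖q‖²` is then
  -- absorbed by the lower bound `hu` and cancelled.
  have h2 : (‖q‖ ^ 2) ^ 2 ≤ (∑ i, d i * a i ^ 2) * Z := by
    rw [h1]
    refine Finset.sum_sq_le_sum_mul_sum_of_sq_le_mul _
      (fun i _ => mul_nonneg (hd i).le (sq_nonneg _))
      (fun i _ => div_nonneg (sq_nonneg _) (hd i).le) fun i _ => ?_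
    have := (hd i).ne'
    apply le_of_eq
    field_simp
  rcases (sq_nonneg ‖q‖).eq_or_lt with h0 | h0
  · rw [← h0]; positivity
  have h3 := mul_le_mul_of_nonneg_right (hu a) hZ
  rw [one_div, ← div_eq_inv_mul, le_div_iff₀ hc]
  refine le_of_mul_le_mul_left ?_ h0
  nlinarith [mul_le_mul_of_nonneg_left h2 hc.le]

/-- Since `m` is the projection of `f + e` on `V` and `q` that of `e`, the vector `m - q` is the
projection of `f`. Pythagoras separates noise from bias, and the bias is compared with the point of
`V` having coefficients `a`. -/
theorem norm_sq_leastSquares_sub_le {g h : Fin K → E} {d : Fin K → ℝ} (hd : ∀ i, 0 < d i) {ρ : ℝ}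
    (hρ : 0 < ρ)
    (hg : ∀ a : Fin K → ℝ, ρ * ∑ i, d i * a i ^ 2 ≤ ‖∑ i, a i • g i‖ ^ 2)
    (hh : ∀ i, 4 * K * ‖h i‖ ^ 2 ≤ ρ * d i) {f e m : E}
    (hm : m ∈ Submodule.span ℝ (Set.range fun i => g i + h i))
    (hort : ∀ u ∈ Submodule.span ℝ (Set.range fun i => g i + h i), inner ℝ (f + e - m) u = 0)
    (a : Fin K → ℝ) :
    ‖m - f‖ ^ 2 ≤ 2 * ‖f - ∑ i, a i • g i‖ ^ 2 + 2 * ‖∑ i, a i • h i‖ ^ 2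
      + 4 / ρ * ∑ i, inner ℝ (g i + h i) e ^ 2 / d i := by
  set V := Submodule.span ℝ (Set.range fun i => g i + h i)
  have : FiniteDimensional ℝ V := FiniteDimensional.span_of_finite ℝ (Set.finite_range _)
  set q := V.starProjection e
  have hqV : q ∈ V := Submodule.starProjection_apply_mem _ _
  have hqort : ∀ u ∈ V, inner ℝ (e - q) u = 0 := fun u hu =>
    Submodule.starProjection_inner_eq_zero _ _ hu
  have hq : ‖q‖ ^ 2 ≤ 1 / (ρ / 4) * ∑ i, inner ℝ (g i + h i) e ^ 2 / d i :=
    norm_sq_le_of_mem_span hd (by positivity) (sum_perturbed_norm_sq_ge hd hρ hg hh) hqV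
      (hqort q hqV)
  have hfort : ∀ u ∈ V, inner ℝ (f - (m - q)) u = 0 := fun u hu => by
    rw [show f - (m - q) = (f + e - m) - (e - q) by abel, inner_sub_left, hort u hu, hqort u hu,
      sub_zero]
  have h1 : ‖m - f‖ ^ 2 = ‖q‖ ^ 2 + ‖f - (m - q)‖ ^ 2 := by
    rw [show m - f = q - (f - (m - q)) by abel, norm_sub_sq_real, real_inner_comm, hfort q hqV]
    ring
  set v := ∑ i, a i • (g i + h i)
  have hvV : v ∈ V := Submodule.sum_mem _ fun i _ =>
    Submodule.smul_mem _ _ (Submodule.subset_span ⟨i, rfl⟩)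
  have h2 : ‖f - (m - q)‖ ^ 2 ≤ ‖f - v‖ ^ 2 := by
    rw [show f - v = (f - (m - q)) + ((m - q) - v) by abel, norm_add_sq_real,
      hfort _ (Submodule.sub_mem _ (Submodule.sub_mem _ hm hqV) hvV)]
    nlinarith [sq_nonneg ‖(m - q) - v‖]
  have h3 : ‖f - v‖ ^ 2 ≤ 2 * ‖f - ∑ i, a i • g i‖ ^ 2 + 2 * ‖∑ i, a i • h i‖ ^ 2 := by
    have hv : f - v = (f - ∑ i, a i • g i) - ∑ i, a i • h i := by
      simp only [v, smul_add, Finset.sum_add_distrib]; abel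
    rw [hv]
    have := parallelogram_law_with_norm ℝ (f - ∑ i, a i • g i) (∑ i, a i • h i)
    nlinarith [mul_self_nonneg ‖(f - ∑ i, a i • g i) + ∑ i, a i • h i‖]
  have h4 : 1 / (ρ / 4) = 4 / ρ := by field_simp
  rw [h4] at hq
  linarith

end LeastSquares

/-! ### Krylov identities -/

section Krylov

variable {n p : ℕ} (X : Matrix (Fin n) (Fin p) ℝ)

lemma gram_posSemidef : (gram X).PosSemidef := by
  have := Matrix.posSemidef_conjTranspose_mul_self X
  rw [Matrix.conjTranspose_eq_transpose_of_trivial] at this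
  exact this.smul (by positivity)

lemma gram_pow_transpose (i : ℕ) : (gram X ^ i)ᵀ = gram X ^ i := by
  rw [Matrix.transpose_pow]
  congr 1
  exact (Matrix.conjTranspose_eq_transpose_of_trivial _).symm.trans (gram_posSemidef X).1

lemma transpose_mul_self_eq (hn : n ≠ 0) : Xᵀ * X = (n : ℝ) • gram X := by
  have : (n : ℝ) ≠ 0 := by exact_mod_cast hn
  rw [gram, smul_smul, mul_one_div_cancel this, one_smul]

lemma mulVec_dotProduct_mulVec (hn : n ≠ 0) (u v : Fin p → ℝ) :
    (X *ᵥ u) ⬝ᵥ (X *ᵥ v) = n * (u ⬝ᵥ (gram X *ᵥ v)) := by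
  rw [Matrix.dotProduct_mulVec, Matrix.vecMul_mulVec, transpose_mul_self_eq X hn,
    ← Matrix.dotProduct_mulVec, Matrix.smul_mulVec, dotProduct_smul, smul_eq_mul]

lemma gram_pow_dotProduct (i : ℕ) (u v : Fin p → ℝ) :
    (gram X ^ i *ᵥ u) ⬝ᵥ v = u ⬝ᵥ (gram X ^ i *ᵥ v) := by
  rw [Matrix.dotProduct_mulVec, ← Matrix.mulVec_transpose, gram_pow_transpose]

/-- The matrix sending the noise to the `i`-th Krylov vector in the observation space. -/
noncomputable def noiseOp (i : ℕ) : Matrix (Fin n) (Fin n) ℝ :=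
  (1 / (n : ℝ)) • (X * gram X ^ i * Xᵀ)

lemma noiseOp_mulVec (i : ℕ) (e : Fin n → ℝ) :
    noiseOp X i *ᵥ e = X *ᵥ (gram X ^ i *ᵥ empCov X e) := by
  rw [noiseOp, empCov, Matrix.smul_mulVec, Matrix.mulVec_smul, Matrix.mulVec_smul,
    Matrix.mulVec_mulVec, Matrix.mulVec_mulVec]

lemma noiseOp_transpose (i : ℕ) : (noiseOp X i)ᵀ = noiseOp X i := by
  rw [noiseOp, Matrix.transpose_smul, Matrix.transpose_mul, Matrix.transpose_mul,
    gram_pow_transpose, Matrix.transpose_transpose, Matrix.mul_assoc]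

/-- Together with symmetry, this turns `‖h i‖²` into a quadratic form whose trace is `Tr
Σ^(2(i+1))`. -/
lemma noiseOp_mul (i j : ℕ) : noiseOp X i * noiseOp X j = noiseOp X (i + j + 1) := by
  have h : (1 / (n : ℝ)) • (Xᵀ * X) = gram X := rfl
  calc noiseOp X i * noiseOp X j
      = (1 / (n : ℝ)) • (X * gram X ^ i * ((1 / (n : ℝ)) • (Xᵀ * X)) * gram X ^ j * Xᵀ) := by
        simp only [noiseOp, Matrix.smul_mul, Matrix.mul_smul, Matrix.mul_assoc]
    _ = _ := by
        rw [h, noiseOp, show i + j + 1 = i + 1 + j by ring]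
        simp only [pow_add, pow_one, Matrix.mul_assoc]

lemma noiseOp_trace (i : ℕ) : (noiseOp X i).trace = (gram X ^ (i + 1)).trace := by
  have h : (1 / (n : ℝ)) • (Xᵀ * X) = gram X := rfl
  rw [noiseOp, Matrix.trace_smul, Matrix.trace_mul_comm, ← Matrix.mul_assoc, ← Matrix.trace_smul,
    ← Matrix.smul_mul, h, ← pow_succ']

lemma noiseOp_posSemidef (i : ℕ) : (noiseOp X i).PosSemidef := by
  have := ((gram_posSemidef X).pow i).mul_mul_conjTranspose_same X
  rw [Matrix.conjTranspose_eq_transpose_of_trivial] at this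
  exact this.smul (by positivity)

lemma empCov_add (u v : Fin n → ℝ) : empCov X (u + v) = empCov X u + empCov X v := by
  rw [empCov, Matrix.mulVec_add, smul_add]; rfl

lemma empCov_mulVec (b : Fin p → ℝ) : empCov X (X *ᵥ b) = gram X *ᵥ b := by
  rw [empCov, gram, Matrix.mulVec_mulVec, Matrix.smul_mulVec]

variable (s : Fin p → ℝ) (K : ℕ)

lemma krylov_mulVec (S : Matrix (Fin p) (Fin p) ℝ) (a : Fin K → ℝ) :
    krylov S s K *ᵥ a = ∑ j, a j • (S ^ (j : ℕ) *ᵥ s) := by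
  ext i
  simp [krylov, Matrix.mulVec, dotProduct, mul_comm]

lemma krylov_transpose_mulVec (S : Matrix (Fin p) (Fin p) ℝ) (v : Fin p → ℝ) (i : Fin K) :
    ((krylov S s K)ᵀ *ᵥ v) i = (S ^ (i : ℕ) *ᵥ s) ⬝ᵥ v := rfl

lemma theta_mulVec (S : Matrix (Fin p) (Fin p) ℝ) (a : Fin K → ℝ) :
    theta S s K *ᵥ a = (krylov S s K)ᵀ *ᵥ (S *ᵥ (krylov S s K *ᵥ a)) := by
  rw [theta, Matrix.mulVec_mulVec, Matrix.mulVec_mulVec]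

lemma theta_isHermitian : (theta (gram X) s K).IsHermitian := by
  have := (gram_posSemidef X).conjTranspose_mul_mul_same (krylov (gram X) s K)
  rw [Matrix.conjTranspose_eq_transpose_of_trivial] at this
  exact this.1

lemma theta_diag (i : Fin K) :
    theta (gram X) s K i i = s ⬝ᵥ (gram X ^ (2 * (i : ℕ) + 1) *ᵥ s) := by
  have h : theta (gram X) s K i i = (theta (gram X) s K *ᵥ Pi.single i 1) i := by simp
  rw [h, theta_mulVec, krylov_transpose_mulVec, krylov_mulVec, gram_pow_dotProduct]
  simp only [Pi.single_apply, ite_smul, one_smul, zero_smul, Finset.sum_ite_eq', Finset.mem_univ,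
    if_true]
  rw [Matrix.mulVec_mulVec, Matrix.mulVec_mulVec, ← pow_succ, ← pow_add]
  congr 3
  ring

lemma norm_sq_design_krylov (hn : n ≠ 0) (a : Fin K → ℝ) :
    (X *ᵥ (krylov (gram X) s K *ᵥ a)) ⬝ᵥ (X *ᵥ (krylov (gram X) s K *ᵥ a))
      = n * (a ⬝ᵥ (theta (gram X) s K *ᵥ a)) := by
  rw [mulVec_dotProduct_mulVec X hn, theta_mulVec, Matrix.dotProduct_mulVec _ (krylov _ _ _)ᵀ,
    Matrix.vecMul_transpose]

variable {s K}

lemma corr_isHermitian : (corr (gram X) s K).IsHermitian := by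
  have := Matrix.isHermitian_mul_mul_conjTranspose
    (Matrix.diagonal fun i => (√(theta (gram X) s K i i))⁻¹) (theta_isHermitian X s K)
  rwa [Matrix.diagonal_conjTranspose, star_trivial] at this

lemma dotProduct_corr_mulVec (b : Fin K → ℝ) :
    b ⬝ᵥ (corr (gram X) s K *ᵥ b) = (fun i => (√(theta (gram X) s K i i))⁻¹ * b i) ⬝ᵥ
      (theta (gram X) s K *ᵥ fun i => (√(theta (gram X) s K i i))⁻¹ * b i) := by
  set r : Fin K → ℝ := fun i => (√(theta (gram X) s K i i))⁻¹
  have hr : (fun i => r i * b i) = Matrix.diagonal r *ᵥ b := by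
    ext i; rw [Matrix.mulVec_diagonal]
  have hr' : (fun i => r i * b i) = b ᵥ* Matrix.diagonal r := by
    ext i; rw [Matrix.vecMul_diagonal, mul_comm]
  change _ = (fun i => r i * b i) ⬝ᵥ (theta (gram X) s K *ᵥ fun i => r i * b i)
  conv_rhs => rw [hr, ← hr, hr']
  rw [← hr', hr, corr, ← Matrix.mulVec_mulVec, ← Matrix.mulVec_mulVec, Matrix.dotProduct_mulVec,
    ← hr', hr]

/-- If a diagonal entry were nonpositive, its inverse square root would be 0 by convention, and the
form of `R` would vanish at a basis vector, against `ρ_min(R) > 0`. -/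
lemma theta_diag_pos (hR : 0 < rhoMin (corr (gram X) s K)) (i : Fin K) :
    0 < theta (gram X) s K i i := by
  have h := rhoMin_mul_dotProduct_le (corr_isHermitian X (s := s) (K := K)) (Pi.single i 1)
  rw [dotProduct_corr_mulVec] at h
  by_contra hneg
  have h0 : √(theta (gram X) s K i i) = 0 := Real.sqrt_eq_zero_of_nonpos (not_lt.1 hneg)
  have hz : (fun j => (√(theta (gram X) s K j j))⁻¹ * (Pi.single i 1 : Fin K → ℝ) j) = 0 := by
    ext j
    rcases eq_or_ne j i with rfl | hj
    · simp [h0]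
    · simp [hj]
  rw [hz, zero_dotProduct] at h
  simp at h
  linarith

lemma theta_form_ge (hR : 0 < rhoMin (corr (gram X) s K)) (a : Fin K → ℝ) :
    rhoMin (corr (gram X) s K) * ∑ i, theta (gram X) s K i i * a i ^ 2
      ≤ a ⬝ᵥ (theta (gram X) s K *ᵥ a) := by
  have hpos := theta_diag_pos X hR
  have h := rhoMin_mul_dotProduct_le (corr_isHermitian X (s := s) (K := K))
    (fun i => √(theta (gram X) s K i i) * a i)
  rw [dotProduct_corr_mulVec] at h
  have ha : (fun i => (√(theta (gram X) s K i i))⁻¹ * (√(theta (gram X) s K i i) * a i)) = a := by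
    ext i
    rw [inv_mul_cancel_left₀ (Real.sqrt_pos.2 (hpos i)).ne']
  rw [ha] at h
  convert h using 2
  refine Finset.sum_congr rfl fun i _ => ?_
  rw [mul_mul_mul_comm, Real.mul_self_sqrt (hpos i).le, sq]

lemma theta_mulVec_lam (hR : 0 < rhoMin (corr (gram X) s K)) :
    theta (gram X) s K *ᵥ lam (gram X) s K = (krylov (gram X) s K)ᵀ *ᵥ s := by
  have hdet : IsUnit (theta (gram X) s K).det := by
    rw [← Matrix.isUnit_iff_isUnit_det, ← Matrix.mulVec_injective_iff_isUnit]
    intro a b hab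
    have h0 : theta (gram X) s K *ᵥ (a - b) = 0 := by
      rw [Matrix.mulVec_sub]; exact sub_eq_zero.2 hab
    have h := theta_form_ge X hR (a - b)
    rw [h0, dotProduct_zero] at h
    have hnn : ∀ i ∈ Finset.univ, 0 ≤ theta (gram X) s K i i * (a - b) i ^ 2 := fun i _ =>
      mul_nonneg (theta_diag_pos X hR i).le (sq_nonneg _)
    have hs : ∑ i, theta (gram X) s K i i * (a - b) i ^ 2 = 0 :=
      le_antisymm (nonpos_of_mul_nonpos_right h hR) (Finset.sum_nonneg hnn)
    ext i
    have := (Finset.sum_eq_zero_iff_of_nonneg hnn).1 hs i (Finset.mem_univ i)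
    rcases mul_eq_zero.1 this with h | h
    · exact absurd h (theta_diag_pos X hR i).ne'
    · exact sub_eq_zero.1 (pow_eq_zero_iff (by norm_num) |>.1 h)
  rw [lam, Matrix.mulVec_mulVec, Matrix.mul_nonsing_inv _ hdet, Matrix.one_mulVec]

/-- `G Λ` attains the distance from `X β` to the image of the population Krylov space. -/
lemma design_sub_lam_le_iInf (hn : n ≠ 0) {β : Fin p → ℝ} (hs : s = gram X *ᵥ β)
    (hR : 0 < rhoMin (corr (gram X) s K)) :
    l2norm (X *ᵥ (β - krylov (gram X) s K *ᵥ lam (gram X) s K)) ^ 2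
      ≤ ⨅ v : colSpan (krylov (gram X) s K), l2norm (X *ᵥ (β - (v : Fin p → ℝ))) ^ 2 := by
  refine le_ciInf ?_
  rintro ⟨v, hv⟩
  obtain ⟨c, rfl⟩ : ∃ c, v = krylov (gram X) s K *ᵥ c := by
    obtain ⟨c, hc⟩ := (Submodule.mem_span_range_iff_exists_fun ℝ).1 hv
    refine ⟨c, ?_⟩
    rw [krylov_mulVec, ← hc]
    rfl
  set l := lam (gram X) s K
  set G := krylov (gram X) s K
  -- These are the normal equations `Θ Λ = Gᵀ σ`, with `σ = Σ β`.
  have hort : (X *ᵥ (G *ᵥ (l - c))) ⬝ᵥ (X *ᵥ (β - G *ᵥ l)) = 0 := by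
    have hl : theta (gram X) s K *ᵥ l = Gᵀ *ᵥ s := theta_mulVec_lam X hR
    have hres : Gᵀ *ᵥ (gram X *ᵥ (β - G *ᵥ l)) = 0 := by
      rw [Matrix.mulVec_sub, Matrix.mulVec_sub, ← hs, ← theta_mulVec, hl, sub_self]
    rw [mulVec_dotProduct_mulVec X hn, dotProduct_comm, Matrix.dotProduct_mulVec,
      ← Matrix.mulVec_transpose, hres, zero_dotProduct, mul_zero]
  have hsplit : X *ᵥ (β - G *ᵥ c) = X *ᵥ (G *ᵥ (l - c)) + X *ᵥ (β - G *ᵥ l) := by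
    rw [← Matrix.mulVec_add, Matrix.mulVec_sub G]
    congr 1
    abel
  change l2norm (X *ᵥ (β - G *ᵥ l)) ^ 2 ≤ l2norm (X *ᵥ (β - G *ᵥ c)) ^ 2
  rw [hsplit, l2norm_sq, l2norm_sq, add_dotProduct, dotProduct_add, dotProduct_add, hort,
    dotProduct_comm (X *ᵥ (β - G *ᵥ l)) (X *ᵥ (G *ᵥ (l - c))), hort]
  have : 0 ≤ (X *ᵥ (G *ᵥ (l - c))) ⬝ᵥ (X *ᵥ (G *ᵥ (l - c))) := by
    rw [← l2norm_sq]; positivity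
  linarith

lemma lamBar_apply (i : Fin K) : lamBar (gram X) s K i
    = (s ⬝ᵥ (gram X ^ (i : ℕ) *ᵥ s)) / theta (gram X) s K i i := by
  rw [lamBar, Matrix.mulVec_diagonal, krylov_transpose_mulVec, gram_pow_dotProduct, inv_mul_eq_div]

/-- This says `σᵀ Σ^(2i+1) σ ≤ ρ^(i+1) σᵀ Σ^i σ`; it lets terms without `Λ̄` be absorbed into the
last sum of the bound. -/
lemma one_le_lamBar_mul (hR : 0 < rhoMin (corr (gram X) s K)) (i : Fin K) :
    1 ≤ lamBar (gram X) s K i * rhoMax (gram X) ^ ((i : ℕ) + 1) := by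
  have hd := theta_diag_pos X hR i
  rw [lamBar_apply, div_mul_eq_mul_div, one_le_div hd]
  have h := (posSemidef_rhoMax_pow_smul_sub (gram_posSemidef X) (i + 1) i).dotProduct_mulVec_nonneg s
  rw [Matrix.sub_mulVec, Matrix.smul_mulVec, dotProduct_sub, dotProduct_smul, smul_eq_mul,
    star_trivial, show (i : ℕ) + (i + 1) = 2 * i + 1 by ring, ← theta_diag] at h
  linarith

end Krylov

/-! ### The least squares characterization -/

lemma IsPLSEstimator.orthogonal {n p K : ℕ} {X : Matrix (Fin n) (Fin p) ℝ} {Y : Fin n → ℝ}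
    {b : Fin p → ℝ} (hb : IsPLSEstimator X Y K b) {u : Fin p → ℝ} (hu : u ∈ loadingSpace X Y K) :
    (Y - X *ᵥ b) ⬝ᵥ (X *ᵥ u) = 0 := by
  -- Minimality along the line `b + c u` gives a nonnegative quadratic in `c` with no constant term,
  -- so its linear coefficient is zero.
  have hq : ∀ c : ℝ, 0 ≤ ((X *ᵥ u) ⬝ᵥ (X *ᵥ u)) * (c * c)
      + (-2 * ((Y - X *ᵥ b) ⬝ᵥ (X *ᵥ u))) * c + 0 := by
    intro c
    have h : l2norm (Y - X *ᵥ b) ^ 2 ≤ l2norm (Y - X *ᵥ (b + c • u)) ^ 2 :=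
      hb.2 (Submodule.add_mem _ hb.1 (Submodule.smul_mem _ c hu))
    rw [Matrix.mulVec_add, Matrix.mulVec_smul, ← sub_sub, l2norm_sq, l2norm_sq] at h
    generalize Y - X *ᵥ b = w at h ⊢
    simp only [sub_dotProduct, dotProduct_sub, smul_dotProduct, dotProduct_smul, smul_eq_mul,
      dotProduct_comm (X *ᵥ u) w] at h
    linarith
  have := discrim_le_zero hq
  rw [discrim] at this
  nlinarith [sq_nonneg ((Y - X *ᵥ b) ⬝ᵥ (X *ᵥ u))]

/-! ### The prediction bound on the good event -/

section Bound

variable {n p K : ℕ} (X : Matrix (Fin n) (Fin p) ℝ)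

lemma inner_toLp_toLp_eq {m : ℕ} (u v : Fin m → ℝ) :
    inner ℝ (WithLp.toLp 2 u : EuclideanSpace ℝ (Fin m)) (WithLp.toLp 2 v) = u ⬝ᵥ v := by
  rw [EuclideanSpace.inner_toLp_toLp, star_trivial, dotProduct_comm]

lemma norm_sq_toLp {m : ℕ} (u : Fin m → ℝ) :
    ‖(WithLp.toLp 2 u : EuclideanSpace ℝ (Fin m))‖ ^ 2 = u ⬝ᵥ u := l2norm_sq u

/-- The prediction error of a PLS estimator, for a given realization of the noise. -/
lemma IsPLSEstimator.prediction_le (hn : n ≠ 0) {β s : Fin p → ℝ} (hs : s = gram X *ᵥ β)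
    (hR : 0 < rhoMin (corr (gram X) s K)) {e : Fin n → ℝ} {b : Fin p → ℝ}
    (hb : IsPLSEstimator X (X *ᵥ β + e) K b)
    (hh : ∀ i : Fin K, 4 * K * ((noiseOp X i *ᵥ e) ⬝ᵥ (noiseOp X i *ᵥ e))
      ≤ rhoMin (corr (gram X) s K) * (n * theta (gram X) s K i i)) :
    l2norm (X *ᵥ b - X *ᵥ β) ^ 2
      ≤ 2 * (⨅ v : colSpan (krylov (gram X) s K), l2norm (X *ᵥ (β - (v : Fin p → ℝ))) ^ 2)
        + 2 * (∑ i, |lam (gram X) s K i| * l2norm (noiseOp X i *ᵥ e)) ^ 2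
        + 4 / rhoMin (corr (gram X) s K) * ∑ i : Fin K,
          ((X *ᵥ (gram X ^ (i : ℕ) *ᵥ s)) ⬝ᵥ e + (noiseOp X i *ᵥ e) ⬝ᵥ e) ^ 2
            / (n * theta (gram X) s K i i) := by
  have hn0 : (0 : ℝ) < n := by exact_mod_cast Nat.pos_of_ne_zero hn
  set l := lam (gram X) s K
  set g : Fin K → EuclideanSpace ℝ (Fin n) :=
    fun i => WithLp.toLp 2 (X *ᵥ (gram X ^ (i : ℕ) *ᵥ s))
  set h : Fin K → EuclideanSpace ℝ (Fin n) := fun i => WithLp.toLp 2 (noiseOp X i *ᵥ e)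
  have hsum : ∀ a : Fin K → ℝ, ∑ i, a i • g i
      = WithLp.toLp 2 (X *ᵥ (krylov (gram X) s K *ᵥ a)) := by
    intro a
    rw [krylov_mulVec, Matrix.mulVec_sum, WithLp.toLp_sum]
    exact Finset.sum_congr rfl fun i _ => by rw [Matrix.mulVec_smul, WithLp.toLp_smul]
  have hemp : empCov X (X *ᵥ β + e) = s + empCov X e := by rw [empCov_add, empCov_mulVec, hs]
  have hgh : ∀ i : Fin K, g i + h i
      = WithLp.toLp 2 (X *ᵥ (gram X ^ (i : ℕ) *ᵥ empCov X (X *ᵥ β + e))) := by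
    intro i
    rw [hemp, Matrix.mulVec_add, Matrix.mulVec_add, ← noiseOp_mulVec, WithLp.toLp_add]
  have hspan : ∀ a : Fin K → ℝ, ∑ i, a i • (g i + h i)
      = WithLp.toLp 2 (X *ᵥ ∑ i, a i • (gram X ^ (i : ℕ) *ᵥ empCov X (X *ᵥ β + e))) := by
    intro a
    rw [Matrix.mulVec_sum, WithLp.toLp_sum]
    exact Finset.sum_congr rfl fun i _ => by rw [hgh, Matrix.mulVec_smul, WithLp.toLp_smul]
  have hm : WithLp.toLp 2 (X *ᵥ b) ∈ Submodule.span ℝ (Set.range fun i => g i + h i) := by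
    have hb1 := hb.1
    rw [loadingSpace_eq_krylovSpan X _ hn] at hb1
    obtain ⟨a, rfl⟩ := (Submodule.mem_span_range_iff_exists_fun ℝ).1 hb1
    exact (Submodule.mem_span_range_iff_exists_fun ℝ).2 ⟨a, hspan a⟩
  have hort : ∀ u ∈ Submodule.span ℝ (Set.range fun i => g i + h i),
      inner ℝ (WithLp.toLp 2 (X *ᵥ β) + WithLp.toLp 2 e - WithLp.toLp 2 (X *ᵥ b)) u = 0 := by
    intro u hu
    obtain ⟨a, rfl⟩ := (Submodule.mem_span_range_iff_exists_fun ℝ).1 hu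
    rw [hspan, ← WithLp.toLp_add, ← WithLp.toLp_sub, inner_toLp_toLp_eq]
    refine hb.orthogonal ?_
    rw [loadingSpace_eq_krylovSpan X _ hn]
    exact (Submodule.mem_span_range_iff_exists_fun ℝ).2 ⟨a, rfl⟩
  -- The weights carry a factor `n` because the Gram matrix of the `g i` is `n Θ`.
  have key := norm_sq_leastSquares_sub_le (g := g) (h := h)
    (d := fun i => n * theta (gram X) s K i i)
    (fun i => mul_pos hn0 (theta_diag_pos X hR i)) hR
    (fun a => by
      rw [hsum, norm_sq_toLp, norm_sq_design_krylov X s K hn]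
      have := mul_le_mul_of_nonneg_left (theta_form_ge X hR a) hn0.le
      refine le_trans (le_of_eq ?_) this
      simp only [Finset.mul_sum]
      exact Finset.sum_congr rfl fun i _ => by ring)
    (fun i => by rw [norm_sq_toLp]; exact hh i) hm hort l
  have h1 : ‖WithLp.toLp 2 (X *ᵥ β) - ∑ i, l i • g i‖ ^ 2
      ≤ ⨅ v : colSpan (krylov (gram X) s K), l2norm (X *ᵥ (β - (v : Fin p → ℝ))) ^ 2 := by
    rw [hsum, ← WithLp.toLp_sub, ← Matrix.mulVec_sub]
    exact design_sub_lam_le_iInf X hn hs hR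
  have h2 : ‖∑ i, l i • h i‖ ^ 2 ≤ (∑ i, |l i| * l2norm (noiseOp X i *ᵥ e)) ^ 2 := by
    gcongr
    refine (norm_sum_le _ _).trans (le_of_eq ?_)
    exact Finset.sum_congr rfl fun i _ => by rw [norm_smul, Real.norm_eq_abs]; rfl
  have h3 : ∀ i, inner ℝ (g i + h i) (WithLp.toLp 2 e)
      = (X *ᵥ (gram X ^ (i : ℕ) *ᵥ s)) ⬝ᵥ e + (noiseOp X i *ᵥ e) ⬝ᵥ e := fun i => by
    rw [inner_add_left, inner_toLp_toLp_eq, inner_toLp_toLp_eq]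
  simp only [h3] at key
  rw [← WithLp.toLp_sub] at key
  change l2norm (X *ᵥ b - X *ᵥ β) ^ 2 ≤ _ at key
  linarith

/-- `6K/δ ≥ 6 > e`. This allows `x` to be bounded by `x²` later. -/
lemma one_le_xDelta (hK : 1 ≤ K) {δ : ℝ} (hδ : δ ∈ Set.Ioo (0 : ℝ) 1) : 1 ≤ xDelta K δ := by
  have hK1 : (1 : ℝ) ≤ K := by exact_mod_cast hK
  rw [xDelta, Real.le_log_iff_exp_le (div_pos (by linarith) hδ.1), le_div_iff₀ hδ.1]
  have := Real.exp_one_lt_d9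
  nlinarith [hδ.1, hδ.2, Real.exp_pos 1]

lemma two_mul_xDelta_le_cDelta : 2 * xDelta K δ ≤ cDelta K δ := by
  refine le_trans ?_ (le_max_left _ _)
  have := Real.sqrt_nonneg (xDelta K δ)
  linarith

lemma le_D1 {R : Matrix (Fin K) (Fin K) ℝ} {δ : ℝ} (hx : 0 ≤ xDelta K δ) (hR : 0 < rhoMin R)
    (hR' : rhoMin R ≤ rhoMax R) : 8 * xDelta K δ ≤ D1 δ R := by
  have hC := two_mul_xDelta_le_cDelta (K := K) (δ := δ)
  have hC0 : 0 ≤ cDelta K δ := by linarith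
  have hM : 0 < rhoMax R := hR.trans_le hR'
  have : 0 ≤ 8 * rhoMin R * cDelta K δ * (1 / (8 * rhoMin R) + rhoMax R / rhoMin R ^ 2) := by
    positivity
  rw [D1]
  linarith

lemma D2_nonneg {R : Matrix (Fin K) (Fin K) ℝ} {δ : ℝ} (hR : 0 < rhoMin R)
    (hR' : rhoMin R ≤ rhoMax R) : 0 ≤ D2 δ R := by
  have hM : 0 < rhoMax R := hR.trans_le hR'
  rw [D2]
  positivity

lemma le_D3 {R : Matrix (Fin K) (Fin K) ℝ} {δ : ℝ} (hx : 0 ≤ xDelta K δ) (hR : 0 < rhoMin R)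
    (hR' : rhoMin R ≤ rhoMax R) : 4 / rhoMin R * (32 * xDelta K δ ^ 2) ≤ D3 δ R := by
  have hC := two_mul_xDelta_le_cDelta (K := K) (δ := δ)
  have hM : 0 < rhoMax R := hR.trans_le hR'
  have h1 : 1 ≤ rhoMax R ^ 3 / rhoMin R ^ 3 := by
    rw [one_le_div (by positivity)]
    gcongr
  have h2 : 0 ≤ 4 * rhoMax R ^ 2 / rhoMin R ^ 2 := by positivity
  have h3 : 4 * xDelta K δ ^ 2 ≤ cDelta K δ ^ 2 := by nlinarith
  calc 4 / rhoMin R * (32 * xDelta K δ ^ 2)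
      = 4 * (4 * xDelta K δ ^ 2 / rhoMin R) * 8 := by ring
    _ ≤ 4 * (cDelta K δ ^ 2 / rhoMin R) * 8 := by gcongr
    _ ≤ D3 δ R := by
        rw [D3]
        gcongr
        linarith

/-- The realizations of the noise on which the prediction bound holds. -/
def goodNoise (s : Fin p → ℝ) (K : ℕ) (τ x : ℝ) : Set (EuclideanSpace ℝ (Fin n)) :=
  ⋂ i : Fin K,
    ({e | (noiseOp X i *ᵥ e.ofLp) ⬝ᵥ (noiseOp X i *ᵥ e.ofLp)
        ≤ 4 * x * τ ^ 2 * (gram X ^ (2 * ((i : ℕ) + 1))).trace} ∩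
      {e | (noiseOp X i *ᵥ e.ofLp) ⬝ᵥ e.ofLp ≤ 4 * x * τ ^ 2 * (gram X ^ ((i : ℕ) + 1)).trace} ∩
      {e | ((X *ᵥ (gram X ^ (i : ℕ) *ᵥ s)) ⬝ᵥ e.ofLp) ^ 2
        ≤ 4 * x * τ ^ 2 * (n * theta (gram X) s K i i)})

variable {X}

lemma trace_gram_pow_nonneg (i : ℕ) : 0 ≤ (gram X ^ i).trace :=
  ((gram_posSemidef X).pow i).trace_nonneg

lemma trace_gram_pow_two_mul_le (i : ℕ) :
    (gram X ^ (2 * i)).trace ≤ rhoMax (gram X) ^ i * (gram X ^ i).trace := by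
  have h := (posSemidef_rhoMax_pow_smul_sub (gram_posSemidef X) i i).trace_nonneg
  rw [Matrix.trace_sub, Matrix.trace_smul, smul_eq_mul, ← two_mul] at h
  linarith

/-- Applied with `d = Θ i i`, `k = K t`, `T = Tr Σ^(i+1)`, `r = ρ(Σ)^(i+1)`, `L = Λ̄ i`, `u = ⟨g i,
e⟩` and `v = ⟨h i, e⟩`. The square of `u` feeds the term `L r`; the square of `v` feeds `L T / k`,
where (A.2) trades one factor `T` for `d`. -/
lemma sq_add_div_le {x : ℝ} (hx : 1 ≤ x) {τ N d k T L r u v : ℝ} (hτ : 0 < τ) (hN : 0 < N)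
    (hd : 0 < d) (hk : 0 < k) (hT : 0 ≤ T) (hLr : 1 ≤ L * r) (hL : 0 ≤ L)
    (hdk : k * (τ ^ 2 / N) * (r * T) ≤ d) (hu : u ^ 2 ≤ 4 * x * τ ^ 2 * (N * d)) (hv0 : 0 ≤ v)
    (hv : v ≤ 4 * x * τ ^ 2 * T) :
    (u + v) ^ 2 / (N * d) ≤ 32 * x ^ 2 * τ ^ 2 * (1 / k * (L * T) + L * r) := by
  have hNd : 0 < N * d := mul_pos hN hd
  have h1 : k * τ ^ 2 * T ^ 2 ≤ N * d * (L * T) := by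
    have h2 : k * τ ^ 2 * (r * T) ≤ N * d := by
      have := mul_le_mul_of_nonneg_left hdk hN.le
      rwa [show N * (k * (τ ^ 2 / N) * (r * T)) = k * τ ^ 2 * (r * T) by field_simp] at this
    calc k * τ ^ 2 * T ^ 2 ≤ k * τ ^ 2 * T ^ 2 * (L * r) := le_mul_of_one_le_right (by positivity) hLr
      _ = k * τ ^ 2 * (r * T) * (L * T) := by ring
      _ ≤ N * d * (L * T) := by gcongr
  have h3 : τ ^ 2 * T ^ 2 ≤ N * d * (1 / k * (L * T)) := by
    rw [show N * d * (1 / k * (L * T)) = (N * d * (L * T)) / k by field_simp, le_div_iff₀ hk]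
    linarith
  have h4 : v ^ 2 ≤ (4 * x * τ ^ 2 * T) ^ 2 := by gcongr
  have h5 : x * (N * d) ≤ x ^ 2 * (N * d * (L * r)) := by
    have : x ≤ x ^ 2 * (L * r) := by nlinarith
    nlinarith
  rw [div_le_iff₀ hNd]
  calc (u + v) ^ 2 ≤ 2 * u ^ 2 + 2 * v ^ 2 := by nlinarith [sq_nonneg (u - v)]
    _ ≤ 2 * (4 * x * τ ^ 2 * (N * d)) + 2 * (4 * x * τ ^ 2 * T) ^ 2 := by gcongr
    _ = 8 * τ ^ 2 * (x * (N * d)) + 32 * x ^ 2 * τ ^ 2 * (τ ^ 2 * T ^ 2) := by ring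
    _ ≤ 32 * τ ^ 2 * (x ^ 2 * (N * d * (L * r)))
        + 32 * x ^ 2 * τ ^ 2 * (N * d * (1 / k * (L * T))) := by
        have : 0 ≤ x ^ 2 * (N * d * (L * r)) := by positivity
        gcongr
        norm_num
    _ = _ := by ring

theorem prediction_bound_of_mem_goodNoise (hn : n ≠ 0) (hK : 1 ≤ K) {β s : Fin p → ℝ}
    (hs : s = gram X *ᵥ β) {τ : ℝ} (hτ : 0 < τ) {δ : ℝ} (hδ : δ ∈ Set.Ioo (0 : ℝ) 1)
    (hR : 0 < rhoMin (corr (gram X) s K)) {t : ℝ}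
    (ht : 128 * xDelta K δ / rhoMin (corr (gram X) s K) ≤ t)
    (hA2 : ∀ i ∈ Finset.Icc 1 K, t * (τ ^ 2 / n) * K * rhoMax (gram X) ^ i * (gram X ^ i).trace
      ≤ s ⬝ᵥ ((gram X ^ (2 * i - 1)) *ᵥ s))
    {e : EuclideanSpace ℝ (Fin n)} (he : e ∈ goodNoise X s K τ (xDelta K δ)) {b : Fin p → ℝ}
    (hb : IsPLSEstimator X (X *ᵥ β + e.ofLp) K b) :
    1 / (n : ℝ) * l2norm (X *ᵥ b - X *ᵥ β) ^ 2 ≤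
      2 / (n : ℝ) * (⨅ v : colSpan (krylov (gram X) s K), l2norm (X *ᵥ (β - (v : Fin p → ℝ))) ^ 2)
      + D1 δ (corr (gram X) s K) * (τ ^ 2 / n) *
          (∑ i : Fin K, √((gram X ^ (2 * ((i : ℕ) + 1))).trace) * |lam (gram X) s K i|) ^ 2
      + D2 δ (corr (gram X) s K) * l2norm (lamTilde (gram X) s K) ^ 2 * (τ ^ 2 / n) *
          ∑ j ∈ Finset.Icc 1 K,
            rhoMax (gram X) ^ (2 * j) / (s ⬝ᵥ ((gram X ^ (2 * j - 1)) *ᵥ s))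
      + D3 δ (corr (gram X) s K) * (τ ^ 2 / n) *
          (1 / (K * t) * ∑ i : Fin K, lamBar (gram X) s K i * (gram X ^ ((i : ℕ) + 1)).trace
            + ∑ i : Fin K, lamBar (gram X) s K i * rhoMax (gram X) ^ ((i : ℕ) + 1)) := by
  have hn0 : (0 : ℝ) < n := by exact_mod_cast Nat.pos_of_ne_zero hn
  have hK0 : (0 : ℝ) < K := by exact_mod_cast hK
  have hx := one_le_xDelta hK hδ
  have hRle : rhoMin (corr (gram X) s K) ≤ rhoMax (corr (gram X) s K) :=
    rhoMin_le_rhoMax (corr_isHermitian X) (by omega)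
  have hrho : 0 ≤ rhoMax (gram X) := rhoMax_nonneg (gram_posSemidef X)
  have hd := theta_diag_pos X hR
  have hD1 := le_D1 (by linarith) hR hRle
  have hD2 := D2_nonneg (δ := δ) hR hRle
  have hD3 := le_D3 (by linarith) hR hRle
  set x := xDelta K δ
  set ρ := rhoMin (corr (gram X) s K)
  set M := rhoMax (gram X)
  have htx : 128 * x ≤ ρ * t := by rwa [div_le_iff₀ hR, mul_comm t] at ht
  have ht0 : 0 < t := pos_of_mul_pos_right (by linarith : 0 < ρ * t) hR.le
  have hdk : ∀ i : Fin K, K * t * (τ ^ 2 / n) * (M ^ ((i : ℕ) + 1) * (gram X ^ ((i : ℕ) + 1)).trace)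
      ≤ theta (gram X) s K i i := by
    intro i
    have := hA2 (i + 1) (Finset.mem_Icc.2 ⟨by omega, by omega⟩)
    rw [show 2 * ((i : ℕ) + 1) - 1 = 2 * i + 1 by omega, ← theta_diag] at this
    refine le_trans (le_of_eq ?_) this
    ring
  have he1 : ∀ i : Fin K, (noiseOp X i *ᵥ e.ofLp) ⬝ᵥ (noiseOp X i *ᵥ e.ofLp)
      ≤ 4 * x * τ ^ 2 * (gram X ^ (2 * ((i : ℕ) + 1))).trace := fun i =>
    (Set.mem_iInter.1 he i).1.1
  have hLr := fun i : Fin K => one_le_lamBar_mul X hR i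
  have hL : ∀ i : Fin K, 0 ≤ lamBar (gram X) s K i := by
    intro i
    rw [lamBar_apply]
    refine div_nonneg ?_ (hd i).le
    have := ((gram_posSemidef X).pow i).dotProduct_mulVec_nonneg s
    rwa [star_trivial] at this
  -- The smallness of `h i` asks only for `16 x ≤ ρ t`, using `Tr Σ^(2(i+1)) ≤ ρ(Σ)^(i+1) Tr
  -- Σ^(i+1)`; the assumption on `t` provides `128 x`.
  have key := hb.prediction_le X hn hs hR fun i => by
    set Q := M ^ ((i : ℕ) + 1) * (gram X ^ ((i : ℕ) + 1)).trace
    have hQ0 : 0 ≤ Q := mul_nonneg (pow_nonneg hrho _) (trace_gram_pow_nonneg _)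
    calc 4 * K * ((noiseOp X i *ᵥ e.ofLp) ⬝ᵥ (noiseOp X i *ᵥ e.ofLp))
        ≤ 4 * K * (4 * x * τ ^ 2 * Q) := by
          gcongr
          refine (he1 i).trans ?_
          gcongr
          exact trace_gram_pow_two_mul_le _
      _ = (16 * x) * (K * τ ^ 2 * Q) := by ring
      _ ≤ (ρ * t) * (K * τ ^ 2 * Q) :=
          mul_le_mul_of_nonneg_right (by linarith) (by positivity)
      _ = ρ * (n * (K * t * (τ ^ 2 / n) * Q)) := by field_simp
      _ ≤ ρ * (n * theta (gram X) s K i i) := by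
          gcongr
          exact hdk i
  have hvar : (∑ i : Fin K, |lam (gram X) s K i| * l2norm (noiseOp X i *ᵥ e.ofLp)) ^ 2
      ≤ 4 * x * τ ^ 2 *
        (∑ i : Fin K, √((gram X ^ (2 * ((i : ℕ) + 1))).trace) * |lam (gram X) s K i|) ^ 2 := by
    have h0 : 0 ≤ 4 * x * τ ^ 2 := by positivity
    calc (∑ i : Fin K, |lam (gram X) s K i| * l2norm (noiseOp X i *ᵥ e.ofLp)) ^ 2
        ≤ (√(4 * x * τ ^ 2) *
          ∑ i : Fin K, √((gram X ^ (2 * ((i : ℕ) + 1))).trace) * |lam (gram X) s K i|) ^ 2 := by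
          have hl0 : ∀ i : Fin K, 0 ≤ l2norm (noiseOp X i *ᵥ e.ofLp) := fun i => norm_nonneg _
          refine pow_le_pow_left₀ (Finset.sum_nonneg fun i _ =>
            mul_nonneg (abs_nonneg _) (hl0 i)) ?_ 2
          rw [Finset.mul_sum]
          refine Finset.sum_le_sum fun i _ => ?_
          rw [← mul_assoc, ← Real.sqrt_mul h0, mul_comm]
          gcongr
          refine Real.le_sqrt_of_sq_le ?_
          rw [l2norm_sq]
          exact he1 i
      _ = _ := by rw [mul_pow, Real.sq_sqrt h0]
  have hnoise : ∑ i : Fin K, ((X *ᵥ (gram X ^ (i : ℕ) *ᵥ s)) ⬝ᵥ e.ofLp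
        + (noiseOp X i *ᵥ e.ofLp) ⬝ᵥ e.ofLp) ^ 2 / (n * theta (gram X) s K i i)
      ≤ 32 * x ^ 2 * τ ^ 2 *
        (1 / (K * t) * ∑ i : Fin K, lamBar (gram X) s K i * (gram X ^ ((i : ℕ) + 1)).trace
            + ∑ i : Fin K, lamBar (gram X) s K i * M ^ ((i : ℕ) + 1)) := by
    rw [Finset.mul_sum, ← Finset.sum_add_distrib, Finset.mul_sum]
    refine Finset.sum_le_sum fun i _ => ?_
    refine sq_add_div_le hx hτ hn0 (hd i) (mul_pos hK0 ht0) (trace_gram_pow_nonneg _) (hLr i) (hL i)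
      (hdk i) (Set.mem_iInter.1 he i).2 ?_ (Set.mem_iInter.1 he i).1.2
    have := (noiseOp_posSemidef X i).dotProduct_mulVec_nonneg e.ofLp
    rwa [star_trivial, dotProduct_comm] at this
  set I := ⨅ v : colSpan (krylov (gram X) s K), l2norm (X *ᵥ (β - (v : Fin p → ℝ))) ^ 2
  set V := (∑ i : Fin K, √((gram X ^ (2 * ((i : ℕ) + 1))).trace) * |lam (gram X) s K i|) ^ 2
  have hV : 0 ≤ V := sq_nonneg _
  set W := 1 / (K * t) * ∑ i : Fin K, lamBar (gram X) s K i * (gram X ^ ((i : ℕ) + 1)).trace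
            + ∑ i : Fin K, lamBar (gram X) s K i * M ^ ((i : ℕ) + 1)
  have hW : 0 ≤ W := by
    refine add_nonneg (mul_nonneg (by positivity) (Finset.sum_nonneg fun i _ => ?_))
      (Finset.sum_nonneg fun i _ => by linarith [hLr i])
    exact mul_nonneg (hL i) (trace_gram_pow_nonneg _)
  have hmid : 0 ≤ D2 δ (corr (gram X) s K) * l2norm (lamTilde (gram X) s K) ^ 2 * (τ ^ 2 / n) *
      ∑ j ∈ Finset.Icc 1 K, M ^ (2 * j) / (s ⬝ᵥ ((gram X ^ (2 * j - 1)) *ᵥ s)) := by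
    refine mul_nonneg (by positivity) (Finset.sum_nonneg fun j hj => ?_)
    refine div_nonneg (pow_nonneg hrho _) (le_trans ?_ (hA2 j hj))
    have := trace_gram_pow_nonneg (X := X) j
    positivity
  calc 1 / (n : ℝ) * l2norm (X *ᵥ b - X *ᵥ β) ^ 2
      ≤ 1 / (n : ℝ) * (2 * I + 2 * (4 * x * τ ^ 2 * V) + 4 / ρ * (32 * x ^ 2 * τ ^ 2 * W)) := by
        refine mul_le_mul_of_nonneg_left (key.trans ?_) (by positivity)
        gcongr
    -- The `0` holds the place of the second term of the bound, which is only known to be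
    -- nonnegative.
    _ = 2 / (n : ℝ) * I + 8 * x * (τ ^ 2 / n) * V + 0
        + 4 / ρ * (32 * x ^ 2) * (τ ^ 2 / n) * W := by ring
    _ ≤ _ := by gcongr

end Bound

/-! ### The probability of the good event -/

section Probability

variable {n p : ℕ} (X : Matrix (Fin n) (Fin p) ℝ)

lemma measurableSet_goodNoise (s : Fin p → ℝ) (K : ℕ) (τ x : ℝ) :
    MeasurableSet (goodNoise X s K τ x) := by
  refine MeasurableSet.iInter fun i => MeasurableSet.inter (MeasurableSet.inter ?_ ?_) ?_
  all_goals
    refine measurableSet_le ?_ measurable_const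
    simp only [dotProduct, Matrix.mulVec]
    fun_prop

/-- A union bound over `3K` events, each a tail of some `‖B e‖²`: `B` is in turn `noiseOp X i`, a
square root of it, and a single row. -/
theorem measure_compl_goodNoise_le (hn : n ≠ 0) (s : Fin p → ℝ) (K : ℕ) {τ : ℝ} (hτ : 0 < τ)
    (x : ℝ) :
    multivariateGaussian (0 : EuclideanSpace ℝ (Fin n)) (τ ^ 2 • (1 : Matrix (Fin n) (Fin n) ℝ))
      (goodNoise X s K τ x)ᶜ ≤ ENNReal.ofReal (6 * K * Real.exp (-x)) := by
  set μ := multivariateGaussian (0 : EuclideanSpace ℝ (Fin n))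
    (τ ^ 2 • (1 : Matrix (Fin n) (Fin n) ℝ))
  have hpos : 0 ≤ 2 * Real.exp (-x) := by positivity
  rw [goodNoise, Set.compl_iInter]
  refine (measure_iUnion_fintype_le μ _).trans ?_
  have hi : ∀ i : Fin K, μ ({e | (noiseOp X i *ᵥ e.ofLp) ⬝ᵥ (noiseOp X i *ᵥ e.ofLp)
        ≤ 4 * x * τ ^ 2 * (gram X ^ (2 * ((i : ℕ) + 1))).trace} ∩
      {e | (noiseOp X i *ᵥ e.ofLp) ⬝ᵥ e.ofLp ≤ 4 * x * τ ^ 2 * (gram X ^ ((i : ℕ) + 1)).trace} ∩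
      {e | ((X *ᵥ (gram X ^ (i : ℕ) *ᵥ s)) ⬝ᵥ e.ofLp) ^ 2
        ≤ 4 * x * τ ^ 2 * (n * theta (gram X) s K i i)})ᶜ
      ≤ ENNReal.ofReal (6 * Real.exp (-x)) := by
    intro i
    rw [Set.compl_inter, Set.compl_inter]
    have h6 : ENNReal.ofReal (6 * Real.exp (-x)) = ENNReal.ofReal (2 * Real.exp (-x))
        + ENNReal.ofReal (2 * Real.exp (-x)) + ENNReal.ofReal (2 * Real.exp (-x)) := by
      rw [← ENNReal.ofReal_add hpos hpos, ← ENNReal.ofReal_add (by positivity) hpos]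
      congr 1
      ring
    rw [h6]
    refine (measure_union_le _ _).trans (add_le_add ((measure_union_le _ _).trans
      (add_le_add ?_ ?_)) ?_)
    · refine le_trans (le_of_eq (congrArg μ ?_)) (gaussian_sq_norm_mulVec_tail hτ (noiseOp X i) x)
      ext e
      rw [noiseOp_transpose, noiseOp_mul, noiseOp_trace,
        show (i : ℕ) + i + 1 + 1 = 2 * (i + 1) by ring]
      simp
    · obtain ⟨B, hB⟩ := exists_eq_transpose_mul_self (noiseOp_posSemidef X i)
      refine le_trans (le_of_eq (congrArg μ ?_)) (gaussian_sq_norm_mulVec_tail hτ B x)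
      ext e
      have hq : (B *ᵥ e.ofLp) ⬝ᵥ (B *ᵥ e.ofLp) = (noiseOp X i *ᵥ e.ofLp) ⬝ᵥ e.ofLp := by
        rw [Matrix.dotProduct_mulVec, ← Matrix.mulVec_transpose, Matrix.mulVec_mulVec, ← hB]
      rw [← hB, noiseOp_trace, Set.mem_ofPred_eq, hq]
      simp
    · refine le_trans (le_of_eq (congrArg μ ?_)) (gaussian_sq_norm_mulVec_tail hτ
        (Matrix.of fun _ : Fin 1 => X *ᵥ (gram X ^ (i : ℕ) *ᵥ s)) x)
      ext e
      have hnorm : (X *ᵥ (gram X ^ (i : ℕ) *ᵥ s)) ⬝ᵥ (X *ᵥ (gram X ^ (i : ℕ) *ᵥ s))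
          = n * theta (gram X) s K i i := by
        rw [mulVec_dotProduct_mulVec X hn, theta_diag, gram_pow_dotProduct, Matrix.mulVec_mulVec,
          Matrix.mulVec_mulVec, ← pow_succ, ← pow_add]
        congr 4
        ring
      rw [trace_transpose_mul_self, ← hnorm]
      generalize X *ᵥ (gram X ^ (i : ℕ) *ᵥ s) = a
      simp [dotProduct, Matrix.mulVec, sq]
  refine (Finset.sum_le_sum fun i _ => hi i).trans (le_of_eq ?_)
  rw [Finset.sum_const, Finset.card_univ, Fintype.card_fin, nsmul_eq_mul,
    ← ENNReal.ofReal_natCast, ← ENNReal.ofReal_mul (by positivity)]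
  congr 1
  ring

end Probability

lemma integral_empCov {Ω : Type*} [MeasurableSpace Ω] {P : Measure Ω} [IsProbabilityMeasure P]
    {n p : ℕ} (X : Matrix (Fin n) (Fin p) ℝ) (β : Fin p → ℝ) {τ : ℝ}
    {ε : Ω → EuclideanSpace ℝ (Fin n)}
    (hε : HasLaw ε (multivariateGaussian 0 (τ ^ 2 • (1 : Matrix (Fin n) (Fin n) ℝ))) P) :
    ∫ ω, empCov X (X *ᵥ β + (ε ω).ofLp) ∂P = gram X *ᵥ β := by
  let T : EuclideanSpace ℝ (Fin n) →ₗ[ℝ] (Fin p → ℝ) :=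
    ((1 / (n : ℝ)) • Xᵀ).mulVecLin ∘ₗ (WithLp.linearEquiv 2 ℝ (Fin n → ℝ)).toLinearMap
  have hT : ∀ e : EuclideanSpace ℝ (Fin n), empCov X e.ofLp = T.toContinuousLinearMap e := by
    intro e
    rw [empCov, ← Matrix.smul_mulVec]
    rfl
  have hint : Integrable ε P := hε.hasGaussianLaw.integrable
  have hmean : ∫ ω, ε ω ∂P = 0 := by
    rw [hε.integral_eq, integral_id_multivariateGaussian]
  simp only [empCov_add, empCov_mulVec]
  simp only [hT]
  rw [integral_add (integrable_const _) (T.toContinuousLinearMap.integrable_comp hint),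
    ContinuousLinearMap.integral_comp_comm _ hint, hmean]
  simp

end PLS

open PLS
theorem mainTheorem3 {Ω : Type*} [MeasurableSpace Ω] (P : Measure Ω) [IsProbabilityMeasure P]
    (n p K : ℕ) (hn : 1 ≤ n) (hK : 1 ≤ K) (hKp : K ≤ p)
    (X : Matrix (Fin n) (Fin p) ℝ) (β : Fin p → ℝ) (τ : ℝ) (hτ : 0 < τ)
    -- the noise and the linear model
    (ε : Ω → EuclideanSpace ℝ (Fin n))
    (hε : HasLaw ε (multivariateGaussian 0 (τ ^ 2 • (1 : Matrix (Fin n) (Fin n) ℝ))) P)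
    (Y : Ω → Fin n → ℝ) (hY : ∀ ω, Y ω = X *ᵥ β + (ε ω).ofLp)
    -- the Gram matrix, the population covariance and the correlation matrix
    (S : Matrix (Fin p) (Fin p) ℝ) (hS : S = gram X)
    (σ : Fin p → ℝ) (hσ : σ = ∫ ω, empCov X (Y ω) ∂P)
    (R : Matrix (Fin K) (Fin K) ℝ) (hR : R = corr S σ K)
    (δ : ℝ) (hδ : δ ∈ Set.Ioo (0 : ℝ) 1)
    -- first assumption
    (hA1 : 0 < rhoMin R)
    -- second assumption
    (t : ℝ) (ht : 128 * Real.log (6 * K / δ) / rhoMin R ≤ t)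
    (hA2 : ∀ i ∈ Finset.Icc 1 K,
      t * (τ ^ 2 / n) * K * rhoMax S ^ i * (S ^ i).trace ≤ σ ⬝ᵥ ((S ^ (2 * i - 1)) *ᵥ σ)) :
    ∃ A : Set Ω, MeasurableSet A ∧ ENNReal.ofReal (1 - δ) ≤ P A ∧
      ∀ ω ∈ A, ∀ b : Fin p → ℝ, IsPLSEstimator X (Y ω) K b →
        1 / (n : ℝ) * l2norm (X *ᵥ b - X *ᵥ β) ^ 2 ≤
          2 / (n : ℝ) * (⨅ v : colSpan (krylov S σ K), l2norm (X *ᵥ (β - (v : Fin p → ℝ))) ^ 2)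
          + D1 δ R * (τ ^ 2 / n) *
              (∑ i : Fin K, √((S ^ (2 * ((i : ℕ) + 1))).trace) * |lam S σ K i|) ^ 2
          + D2 δ R * l2norm (lamTilde S σ K) ^ 2 * (τ ^ 2 / n) *
              ∑ j ∈ Finset.Icc 1 K, rhoMax S ^ (2 * j) / (σ ⬝ᵥ ((S ^ (2 * j - 1)) *ᵥ σ))
          + D3 δ R * (τ ^ 2 / n) *
              (1 / (K * t) * ∑ i : Fin K, lamBar S σ K i * (S ^ ((i : ℕ) + 1)).trace
                + ∑ i : Fin K, lamBar S σ K i * rhoMax S ^ ((i : ℕ) + 1)) := by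
  subst hS hR
  have hn' : n ≠ 0 := by omega
  have hs : σ = gram X *ᵥ β := by
    rw [hσ, ← integral_empCov X β hε]
    simp only [hY]
  set E := goodNoise X σ K τ (xDelta K δ)
  have hE : MeasurableSet E := measurableSet_goodNoise X σ K τ _
  -- `ε` is only almost everywhere measurable, so the bad preimage is replaced by a measurable
  -- superset of the same measure.
  set B := toMeasurable P (ε ⁻¹' Eᶜ)
  have hPB : P B ≤ ENNReal.ofReal δ := by
    rw [measure_toMeasurable, ← Measure.map_apply_of_aemeasurable hε.aemeasurable hE.compl,
      hε.map_eq]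
    refine (measure_compl_goodNoise_le X hn' σ K hτ _).trans (le_of_eq ?_)
    have hK0 : (0 : ℝ) < K := by exact_mod_cast hK
    rw [xDelta, Real.exp_neg, Real.exp_log (div_pos (by positivity) hδ.1)]
    congr 1
    field_simp
  have hBm : MeasurableSet B := measurableSet_toMeasurable _ _
  refine ⟨Bᶜ, hBm.compl, ?_, fun ω hω b hb => ?_⟩
  · rw [prob_compl_eq_one_sub hBm, ENNReal.ofReal_sub _ hδ.1.le, ENNReal.ofReal_one]
    exact tsub_le_tsub_left hPB _
  · have he : ε ω ∈ E := by
      by_contra h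
      exact hω (subset_toMeasurable P _ h)
    rw [hY] at hb
    exact prediction_bound_of_mem_goodNoise hn' hK hs hτ hδ hA1 ht hA2 he hb
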